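/- Let $\mathcal K$ be an idempotent complete, strongly closed tensor triangulated category with translation $T$: that is, $\mathcal K$ is a triangulated category with a symmetric monoidal structure $\otimes$ that is exact in each variable and for which the two isomorphisms $T(a)\otimes T(b)\to T^2(a\otimes b)$ differ by a sign; $\otimes$ admits a bi-exact internal hom $\underline{\hom}$; and every object is strongly dualizable, i.e. the natural morphism $\underline{\hom}(a,\mathbb 1)\otimes b\to\underline{\hom}(a,b)$ is an isomorphism for all $a,b$. Let $\operatorname{Spc}(\mathcal K)$ be its spectrum: the set of prime ideals $\mathcal P\subsetneq\mathcal K$ (proper thick triangulated $\otimes$-ideals such that $a\otimes b\in\mathcal P$ implies $a\in\mathcal P$ or $b\in\mathcal P$), with the topology generated by the complements of the supports $\operatorname{supp}(a)=\{\mathcal P\mid a\notin\mathcal P\}$. For $U\subset\operatorname{Spc}(\mathcal K)$ open, let $\mathcal K(U)$ be the idempotent completion of the Verdier quotient of $\mathcal K$ by the full subcategory of those objects $a$ with $\operatorname{supp}(a)\cap U=\varnothing$. There are restriction functors $\mathcal K\to\mathcal K(U)$ and $\mathcal K(U)\to\mathcal K(V)$ for $V\subset U$; they are omitted from the notation, a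 statement "on $V$" being one about the restrictions to $\mathcal K(V)$, and $\operatorname{Mor}_V$ denoting morphisms in $\mathcal K(V)$ between the restrictions. **Theorem (Connective gluing of several objects).** Let $n\ge 2$ and let $\operatorname{Spc}(\mathcal K)=U_1\cup\dots\cup U_n$ be a covering by quasi-compact open subsets. Let $a_i\in\mathcal K(U_i)$ be objects and $\sigma_{ji}\colon a_i\xrightarrow{\sim}a_j$ isomorphisms on $U_i\cap U_j$, for $1\le i,j\le n$, such that $\sigma_{kj}\sigma_{ji}=\sigma_{ki}$ on $U_i\cap U_j\cap U_k$ for all $1\le i,j,k\le n$. Assume the connectivity condition: for every $i=2,\dots,n$ and every quasi-compact open $V\subset U_i$, $$\operatorname{Mor}_V(Ta_i,a_i)=0 ;$$ it is in fact enough to assume this for those $V$ that are finite unions of intersections of the sets $U_1,\dots,U_n$. Then there exists a gluing, i.e. an object $a\in\mathcal K$ with isomorphisms $f_i\colon a\xrightarrow{\sim}a_i$ on $U_i$ for $1\le i\le n$ such that $\sigma_{ji}f_i=f_j$ on $U_i\cap U_j$ for all $1\le i,j\le n$. It is unique up to unique isomorphism: for any two gluings $(a,f_1,\dots,f_n)$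 and $(a',f_1',\dots,f_n')$ there is exactly one isomorphism $f\colon a\xrightarrow{\sim}a'$ in $\mathcal K$ such that $f_i'f=f_i$ on $U_i$ for all $i$. -/

import Mathlib

open CategoryTheory CategoryTheory.Limits CategoryTheory.Pretriangulated
open CategoryTheory.MonoidalCategory CategoryTheory.Idempotents TopologicalSpace

universe v u

namespace TTGlue

/-! ## Tensor triangulated categories -/

section Structures

variable (K : Type u) [Category.{v} K] [Preadditive K] [HasZeroObject K] [HasShift K ℤ]
  [∀ n : ℤ, (shiftFunctor K n).Additive] [Pretriangulated K] [MonoidalCategory K]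

/-- A tensor triangulated category: all the functors `a ⊗ -` and `- ⊗ b` are exact
(they come with isomorphisms `a ⊗ b⟦n⟧ ≅ (a ⊗ b)⟦n⟧`, `a⟦n⟧ ⊗ b ≅ (a ⊗ b)⟦n⟧` and preserve
distinguished triangles), and the two ways from `T a ⊗ T b` to `T (T (a ⊗ b))` anticommute. -/
class TensorTriangulated where
  commShiftLeft (a : K) : (tensorLeft a).CommShift ℤ
  commShiftRight (b : K) : (tensorRight b).CommShift ℤ
  exactLeft (a : K) : (tensorLeft a).IsTriangulated
  exactRight (b : K) : (tensorRight b).IsTriangulated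
  anticomm (a b : K) :
    ((tensorLeft (a⟦(1 : ℤ)⟧)).commShiftIso (1 : ℤ)).hom.app b ≫
        (((tensorRight b).commShiftIso (1 : ℤ)).hom.app a)⟦(1 : ℤ)⟧' =
      -(((tensorRight (b⟦(1 : ℤ)⟧)).commShiftIso (1 : ℤ)).hom.app a ≫
        (((tensorLeft a).commShiftIso (1 : ℤ)).hom.app b)⟦(1 : ℤ)⟧')

variable {K} in
/-- The dual `D a = hom(a, 𝟙)`. -/
noncomputable def dual [MonoidalClosed K] (a : K) : K := (ihom a).obj (𝟙_ K)

variable {K} in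
/-- The natural morphism `D a ⊗ b ⟶ hom(a, b)`, adjoint to
`a ⊗ (D a ⊗ b) ≅ (a ⊗ D a) ⊗ b ⟶ 𝟙 ⊗ b ≅ b`. -/
noncomputable def dualTensorHom [MonoidalClosed K] (a b : K) :
    dual a ⊗ b ⟶ (ihom a).obj b :=
  MonoidalClosed.curry
    ((α_ a (dual a) b).inv ≫ ((ihom.ev a).app (𝟙_ K) ▷ b) ≫ (λ_ b).hom)

open scoped CategoryTheory.Pretriangulated.Opposite in
/-- Strongly closed: the internal hom functor `Kᵒᵖ × K ⥤ K` is bi-exact and every object is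
strongly dualizable. -/
class StronglyClosed [MonoidalClosed K] : Prop where
  exact_right (a : K) : ∃ _ : (ihom a).CommShift ℤ, (ihom a).IsTriangulated
  exact_left (b : K) :
    ∃ _ : ((MonoidalClosed.internalHom (C := K)).flip.obj b).CommShift ℤ,
      ((MonoidalClosed.internalHom (C := K)).flip.obj b).IsTriangulated
  isIso_dualTensorHom (a b : K) : IsIso (dualTensorHom a b)

/-! ## The spectrum -/

/-- A prime ideal of `K`: a proper, thick, triangulated (full, replete) subcategory which is a
tensor ideal and is prime. -/
structure Spc where
  carrier : ObjectProperty K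
  isClosedUnderIsomorphisms : carrier.IsClosedUnderIsomorphisms
  isTriangulated : carrier.IsTriangulated
  thick (a b : K) : carrier (a ⊞ b) → carrier a ∧ carrier b
  ideal (a b : K) : carrier a → carrier (a ⊗ b)
  prime (a b : K) : carrier (a ⊗ b) → carrier a ∨ carrier b
  proper : ∃ a, ¬ carrier a

variable {K} in
/-- The support of an object. -/
def supp (a : K) : Set (Spc K) := {P | ¬ P.carrier a}

/-- The Zariski topology, generated by the complements of the supports. -/
instance : TopologicalSpace (Spc K) :=
  TopologicalSpace.generateFrom {U | ∃ a : K, U = (supp a)ᶜ}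

end Structures

section Restriction

variable {K : Type u} [Category.{v} K] [Preadditive K] [HasZeroObject K] [HasShift K ℤ]
  [∀ n : ℤ, (shiftFunctor K n).Additive] [Pretriangulated K] [MonoidalCategory K]

/-- The full subcategory `K_Z` of the objects supported on `Z`. -/
def supportedOn (Z : Set (Spc K)) : ObjectProperty K := fun a => supp a ⊆ Z

lemma supportedOn_iff (Z : Set (Spc K)) (a : K) :
    supportedOn Z a ↔ ∀ P : Spc K, P ∉ Z → P.carrier a := by
  constructor
  · intro h P hP
    by_contra h'
    exact hP (h h')
  · intro h P hP
    by_contra h'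
    exact hP (h P h')

lemma supportedOn_mono {Z Z' : Set (Spc K)} (h : Z ⊆ Z') :
    supportedOn Z ≤ supportedOn Z' := fun _ ha => ha.trans h

instance (Z : Set (Spc K)) : (supportedOn Z).IsClosedUnderIsomorphisms where
  of_iso e h := by
    rw [supportedOn_iff] at h ⊢
    intro P hP
    have := P.isClosedUnderIsomorphisms
    exact P.carrier.prop_of_iso e (h P hP)

open scoped ZeroObject in
instance (Z : Set (Spc K)) : (supportedOn Z).IsTriangulated where
  exists_zero := by
    refine ⟨0, isZero_zero K, ?_⟩
    rw [supportedOn_iff]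
    intro P _
    have := P.isClosedUnderIsomorphisms
    have := P.isTriangulated
    exact P.carrier.prop_zero
  isStableUnderShiftBy n :=
    { le_shift := by
        intro a h
        simp only [ObjectProperty.prop_shift_iff]
        rw [supportedOn_iff] at h ⊢
        intro P hP
        have := P.isTriangulated
        exact P.carrier.le_shift n _ (h P hP) }
  toIsTriangulatedClosed₂ := .mk' (by
    intro T hT h₁ h₃
    rw [supportedOn_iff] at h₁ h₃ ⊢
    intro P hP
    have := P.isClosedUnderIsomorphisms
    have := P.isTriangulated
    exact P.carrier.ext_of_isTriangulatedClosed₂ T hT (h₁ P hP) (h₃ P hP))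

/-- The morphisms with cone in `K_Z`, where `Z` is the complement of `U`. -/
abbrev uIso (U : Opens (Spc K)) : MorphismProperty K := (supportedOn (U : Set (Spc K))ᶜ).trW

lemma uIso_anti {U V : Opens (Spc K)} (h : V ≤ U) : uIso U ≤ uIso V := by
  rintro _ _ _ ⟨c, g, k, hT, hc⟩
  exact ⟨c, g, k, hT, supportedOn_mono (Set.compl_subset_compl.2 h) _ hc⟩

/-- The Verdier localization `L(U) = K / K_Z`, where `Z` is the complement of `U`. -/
abbrev LU (U : Opens (Spc K)) := (uIso U).Localization

/-- The category `K(U)`: the idempotent completion of `L(U)`. -/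
abbrev KU (U : Opens (Spc K)) := Karoubi (LU U)

/-- The localization functor `L(U) ⥤ L(V)` for `V ⊆ U`: the unique functor that is compatible
with the localization functors from `K`. -/
noncomputable def resL {U V : Opens (Spc K)} (h : V ≤ U) : LU U ⥤ LU V :=
  Localization.Construction.lift (uIso V).Q
    (fun _ _ f hf => (uIso V).Q_inverts f (uIso_anti h f hf))

lemma Q_resL {U V : Opens (Spc K)} (h : V ≤ U) : (uIso U).Q ⋙ resL h = (uIso V).Q :=
  Localization.Construction.fac _ _

lemma resL_comp {U V W : Opens (Spc K)} (h : V ≤ U) (h' : W ≤ V) :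
    resL (h'.trans h) = resL h ⋙ resL h' := by
  apply Localization.Construction.uniq
  rw [← Functor.assoc, Q_resL, Q_resL, Q_resL]

/-- The restriction functor `K(U) ⥤ K(V)` for `V ⊆ U`. -/
noncomputable def res {U V : Opens (Spc K)} (h : V ≤ U) : KU U ⥤ KU V :=
  (functorExtension₂ _ _).obj (resL h)

/-- The restriction functor `K ⥤ K(U)`. -/
noncomputable def rho (U : Opens (Spc K)) : K ⥤ KU U := (uIso U).Q ⋙ toKaroubi _

lemma res_comp {U V W : Opens (Spc K)} (h : V ≤ U) (h' : W ≤ V) :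
    res (h'.trans h) = res h ⋙ res h' := by
  unfold res
  rw [resL_comp h h']
  rfl

lemma rho_comp {U V : Opens (Spc K)} (h : V ≤ U) : rho V = rho U ⋙ res h := by
  unfold rho
  rw [← Q_resL h]
  rfl

/-- The canonical identification of the restriction from `U` to `W` with the restriction from
`U` to `V` followed by the restriction from `V` to `W` (the two functors are equal). -/
noncomputable def resCompIso {U V W : Opens (Spc K)} (h : V ≤ U) (h' : W ≤ V) :
    res (h'.trans h) ≅ res h ⋙ res h' := eqToIso (res_comp h h')

/-- The canonical identification of the restriction from `K` to `K(V)` with the restriction from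
`K` to `K(U)` followed by the restriction from `U` to `V` (the two functors are equal). -/
noncomputable def rhoCompIso {U V : Opens (Spc K)} (h : V ≤ U) : rho V ≅ rho U ⋙ res h :=
  eqToIso (rho_comp h)

/-- An isomorphism `a ≅ b` on `V`, for `a` in `K(U)`, `b` in `K(U')` and `V ⊆ U`, `V ⊆ U'`. -/
abbrev IsoOn {U U' : Opens (Spc K)} (V : Opens (Spc K)) (h : V ≤ U) (h' : V ≤ U')
    (a : KU U) (b : KU U') := (res h).obj a ≅ (res h').obj b

/-- The restriction to `W ⊆ V` of an isomorphism on `V`. -/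
noncomputable def IsoOn.restrict {U U' V W : Opens (Spc K)} {h : V ≤ U} {h' : V ≤ U'} {a : KU U} {b : KU U'}
    (f : IsoOn V h h' a b) (hW : W ≤ V) : IsoOn W (hW.trans h) (hW.trans h') a b :=
  (resCompIso h hW).app a ≪≫ (res hW).mapIso f ≪≫ (resCompIso h' hW).symm.app b

/-- The restriction to `V ⊆ U`, as an isomorphism out of the restriction of `a` to `V`, of an
isomorphism on `U` from (the restriction of) an object `a` of `K`. -/
noncomputable def restrictFromGlobal {U V : Opens (Spc K)} {a : K} {b : KU U}
    (f : (rho U).obj a ≅ b) (h : V ≤ U) : (rho V).obj a ≅ (res h).obj b :=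
  (rhoCompIso h).app a ≪≫ (res h).mapIso f

/-- The translation `T` on `K(U)`. -/
noncomputable def shiftKU [IsTriangulated K] (U : Opens (Spc K)) : KU U ⥤ KU U :=
  (functorExtension₂ _ _).obj (shiftFunctor (LU U) (1 : ℤ))

/-! ## Gluing -/

/-- The objects `a i` in `K(U i)` and the isomorphisms `σ i j : a i ≅ a j` on `U i ⊓ U j`
(usually written `σ_{ji}`) satisfy the cocycle condition on the triple intersections. -/
def IsCocycle {n : ℕ} (U : Fin n → Opens (Spc K)) (a : ∀ i, KU (U i))
    (σ : ∀ i j, IsoOn (U i ⊓ U j) inf_le_left inf_le_right (a i) (a j)) : Prop :=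
  ∀ i j k,
    (σ i j).restrict (W := U i ⊓ U j ⊓ U k) inf_le_left ≪≫
      (σ j k).restrict (W := U i ⊓ U j ⊓ U k) (inf_le_inf_right _ inf_le_right) =
    (σ i k).restrict (W := U i ⊓ U j ⊓ U k) (inf_le_inf_right _ inf_le_left)

/-- A gluing: an object of `K` with isomorphisms to `a i` on `U i`, compatible with the `σ i j`
on `U i ⊓ U j`. -/
structure Gluing {n : ℕ} (U : Fin n → Opens (Spc K)) (a : ∀ i, KU (U i))
    (σ : ∀ i j, IsoOn (U i ⊓ U j) inf_le_left inf_le_right (a i) (a j)) where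
  obj : K
  iso (i : Fin n) : (rho (U i)).obj obj ≅ a i
  compat (i j : Fin n) :
    restrictFromGlobal (V := U i ⊓ U j) (iso i) inf_le_left ≪≫ σ i j =
      restrictFromGlobal (V := U i ⊓ U j) (iso j) inf_le_right

/-- An isomorphism `f` of the underlying objects is an isomorphism of gluings. -/
def Gluing.IsGluingIso {n : ℕ} {U : Fin n → Opens (Spc K)} {a : ∀ i, KU (U i)}
    {σ : ∀ i j, IsoOn (U i ⊓ U j) inf_le_left inf_le_right (a i) (a j)}
    (g g' : Gluing U a σ) (f : g.obj ≅ g'.obj) : Prop :=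
  ∀ i, (rho (U i)).mapIso f ≪≫ g'.iso i = g.iso i

end Restriction

end TTGlue

/-! An object of `K(U)` is handled as an idempotent in the Verdier quotient `L(U)` on an object of
`K`, and an isomorphism as a pair of morphisms `IdemIso` in `L(U)`. The work thus takes place in the
triangulated categories `L(U)`, before idempotent completion.

For `W = U ∪ V`, the kernels of `L(W) ⥤ L(U)` and `L(W) ⥤ L(V)` are orthogonal in both directions
(`homZero_ker`): by rigidity a morphism `a ⟶ b` factors through `a ⊗ (D a ⊗ b)`, which is supported
on `supp a ∩ supp b`. Rigidity also makes thick ideals radical. With quasi-compactness, which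
presents the complements of `U` and `V` as supports of objects, it follows that an object vanishing
on `U ∩ V` is a retract of a sum of objects of the two kernels (`dec_Q_obj`). So a morphism on `W`
that vanishes on `U ∩ V` is the sum of one vanishing on `U` and one vanishing on `V`.

This yields Mayer-Vietoris. Morphisms that agree on `U ∩ V` glue (`exists_hom_of_eq_on_inf`), and
the ambiguity comes from `Mor(T x, y)` on `U ∩ V` (`eq_zero_of_resHom_eq_zero`). Two objects glue
along an isomorphism on `U ∩ V` without any connectivity (`exists_gluing_pair`).

For more objects, the members of the covering are added one at a time. The object glued so far must
be identified with the next `a_i` on their overlap, by an isomorphism assembled from the given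
pieces. Connectivity makes morphisms locally determined, hence glueable. The first member is never
the one added, so it needs no connectivity. On the whole space objects of empty support are zero, so
`K ⥤ L(⊤)` is fully faithful, and the resulting idempotent splits in `K`. -/

set_option linter.unusedSectionVars false

namespace TTGlue

open scoped ZeroObject

/-! ### Mutually orthogonal triangulated subcategories -/

section Orthogonal

variable {T : Type u} [Category.{v} T] [Preadditive T] [HasZeroObject T] [HasShift T ℤ]
  [∀ n : ℤ, (shiftFunctor T n).Additive] [Pretriangulated T]

/-- The morphism `f` factors through an object with the property `I`. -/
def FactorsThrough (I : ObjectProperty T) {a b : T} (f : a ⟶ b) : Prop :=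
  ∃ z, I z ∧ ∃ (u : a ⟶ z) (w : z ⟶ b), u ≫ w = f

lemma FactorsThrough.precomp {I : ObjectProperty T} {a b c : T} {f : b ⟶ c}
    (h : FactorsThrough I f) (g : a ⟶ b) : FactorsThrough I (g ≫ f) := by
  obtain ⟨z, hz, u, w, rfl⟩ := h
  exact ⟨z, hz, g ≫ u, w, by simp⟩

lemma FactorsThrough.postcomp {I : ObjectProperty T} {a b c : T} {f : a ⟶ b}
    (h : FactorsThrough I f) (g : b ⟶ c) : FactorsThrough I (f ≫ g) := by
  obtain ⟨z, hz, u, w, rfl⟩ := h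
  exact ⟨z, hz, u, w ≫ g, by simp⟩

/-- The morphism `f` is the sum of a morphism that factors through `I` and a morphism that
factors through `J`. -/
def Decomposes (I J : ObjectProperty T) {a b : T} (f : a ⟶ b) : Prop :=
  ∃ f₁ f₂ : a ⟶ b, FactorsThrough I f₁ ∧ FactorsThrough J f₂ ∧ f = f₁ + f₂

lemma Decomposes.precomp {I J : ObjectProperty T} {a b c : T} {f : b ⟶ c}
    (h : Decomposes I J f) (g : a ⟶ b) : Decomposes I J (g ≫ f) := by
  obtain ⟨f₁, f₂, h₁, h₂, rfl⟩ := h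
  exact ⟨_, _, h₁.precomp g, h₂.precomp g, by simp⟩

lemma Decomposes.postcomp {I J : ObjectProperty T} {a b c : T} {f : a ⟶ b}
    (h : Decomposes I J f) (g : b ⟶ c) : Decomposes I J (f ≫ g) := by
  obtain ⟨f₁, f₂, h₁, h₂, rfl⟩ := h
  exact ⟨_, _, h₁.postcomp g, h₂.postcomp g, by simp⟩

/-- There are no nonzero morphisms from objects in `I` to objects in `J`. -/
def HomZero (I J : ObjectProperty T) : Prop := ∀ ⦃x y : T⦄, I x → J y → ∀ f : x ⟶ y, f = 0

lemma FactorsThrough.comp_eq_zero {I J : ObjectProperty T} (h : HomZero I J) {a b c : T}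
    {f : a ⟶ b} {g : b ⟶ c} (hf : FactorsThrough I f) (hg : FactorsThrough J g) :
    f ≫ g = 0 := by
  obtain ⟨x, hx, u, w, rfl⟩ := hf
  obtain ⟨y, hy, u', w', rfl⟩ := hg
  have := h hx hy (w ≫ u')
  simp only [Category.assoc]
  rw [← Category.assoc w, this]
  simp

/-- Objects whose identity is the sum of an endomorphism through `I` and one through `J`. -/
def dec (I J : ObjectProperty T) : ObjectProperty T := fun z => Decomposes I J (𝟙 z)

lemma Decomposes.of_dec {I J : ObjectProperty T} {a z b : T} (hz : dec I J z)
    (f : a ⟶ z) (g : z ⟶ b) : Decomposes I J (f ≫ g) := by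
  have := (Decomposes.precomp hz f).postcomp g
  simpa using this

variable {I J : ObjectProperty T} [I.IsTriangulated] [I.IsClosedUnderIsomorphisms]
  [J.IsTriangulated] [J.IsClosedUnderIsomorphisms]

lemma exists_iso_biprod_of_extensionProduct (hJI : HomZero J I) {z : T}
    (hz : I.extensionProduct J z) : ∃ x y, I x ∧ J y ∧ Nonempty (z ≅ x ⊞ y) := by
  obtain ⟨x, y, f, g, h, hT, hx, hy⟩ := hz
  have h0 : h = 0 := hJI hy (I.le_shift (1 : ℤ) _ hx) h
  obtain ⟨e, -⟩ := exists_iso_binaryBiproduct_of_distTriang _ hT h0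
  exact ⟨x, y, hx, hy, ⟨e⟩⟩

lemma extensionProduct_of_iso_biprod {z x y : T} (hx : I x) (hy : J y) (e : z ≅ x ⊞ y) :
    I.extensionProduct J z :=
  (I.extensionProduct J).prop_of_iso e.symm
    ⟨x, y, _, _, _, binaryBiproductTriangle_distinguished x y, hx, hy⟩

/-- The connecting map goes from `I` to `J`, so the triangle splits and its summands can be swapped.
-/
lemma extensionProduct_comm_le (hIJ : HomZero I J) :
    J.extensionProduct I ≤ I.extensionProduct J := by
  intro z hz
  obtain ⟨y, x, f, g, h, hT, hy, hx⟩ := hz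
  have h0 : h = 0 := hIJ hx (J.le_shift (1 : ℤ) _ hy) h
  obtain ⟨e, -⟩ := exists_iso_binaryBiproduct_of_distTriang _ hT h0
  exact (I.extensionProduct J).prop_of_iso (e ≪≫ biprod.braiding _ _).symm
    ⟨x, y, _, _, _, binaryBiproductTriangle_distinguished x y, hx, hy⟩

/-- The inner `J * I` of `I * J * I * J` is turned into `I * J`; equal neighbours then absorb each
other. -/
lemma extensionProduct_extensionProduct_le [IsTriangulated T] (hIJ : HomZero I J) :
    (I.extensionProduct J).extensionProduct (I.extensionProduct J) ≤ I.extensionProduct J := by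
  rw [ObjectProperty.extensionProduct_assoc, ← ObjectProperty.extensionProduct_assoc J I J]
  refine (ObjectProperty.monotone_extensionProduct_right _
    (ObjectProperty.monotone_extensionProduct_left _ (extensionProduct_comm_le hIJ))).trans ?_
  rw [ObjectProperty.extensionProduct_assoc I J J, ← ObjectProperty.extensionProduct_assoc]
  exact (ObjectProperty.monotone_extensionProduct_left _
    (ObjectProperty.extensionProduct_le_of_isTriangulatedClosed₂ le_rfl le_rfl)).trans
    (ObjectProperty.monotone_extensionProduct_right _
      (ObjectProperty.extensionProduct_le_of_isTriangulatedClosed₂ le_rfl le_rfl))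

/-- The two factorizations of a decomposed identity exhibit a retract of `x ⊞ y`. Conversely
orthogonality splits an extension, and its two projectors decompose the identity of a retract. -/
lemma dec_eq_retractClosure (hJI : HomZero J I) :
    dec I J = (I.extensionProduct J).retractClosure := by
  ext z
  constructor
  · rintro ⟨f₁, f₂, ⟨x, hx, u, w, rfl⟩, ⟨y, hy, u', w', rfl⟩, h⟩
    exact ⟨x ⊞ y, extensionProduct_of_iso_biprod hx hy (Iso.refl _),
      ⟨⟨biprod.lift u u', biprod.desc w w', by simp [h]⟩⟩⟩
  · rintro ⟨z', hz', ⟨r⟩⟩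
    obtain ⟨x, y, hx, hy, ⟨e⟩⟩ := exists_iso_biprod_of_extensionProduct hJI hz'
    refine ⟨_, _, ⟨x, hx, r.i ≫ e.hom ≫ biprod.fst, biprod.inl ≫ e.inv ≫ r.r, rfl⟩,
      ⟨y, hy, r.i ≫ e.hom ≫ biprod.snd, biprod.inr ≫ e.inv ≫ r.r, rfl⟩, ?_⟩
    have : r.i ≫ e.hom ≫ (biprod.fst ≫ biprod.inl + biprod.snd ≫ biprod.inr) ≫ e.inv ≫ r.r
        = 𝟙 z := by
      rw [biprod.total]; simp
    rw [← this]
    simp only [Preadditive.add_comp, Preadditive.comp_add, Category.assoc]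

lemma dec_isTriangulated [IsTriangulated T] (hIJ : HomZero I J) (hJI : HomZero J I) :
    (dec I J).IsTriangulated := by
  rw [dec_eq_retractClosure hJI]
  have h₂ : (I.extensionProduct J).retractClosure.IsTriangulatedClosed₂ := .mk' (by
    intro t ht h₁ h₃
    have := ObjectProperty.extensionProduct_retractClosure_retractClosure_le
      (I.extensionProduct J) (I.extensionProduct J) t.obj₂
      ⟨_, _, _, _, _, ht, h₁, h₃⟩
    exact ObjectProperty.monotone_retractClosure (extensionProduct_extensionProduct_le hIJ) _ this)
  have h₀ : I.extensionProduct J (0 : T) :=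
    ⟨0, 0, _, _, _, contractible_distinguished 0, I.prop_zero, J.prop_zero⟩
  exact
    { exists_zero := ⟨0, isZero_zero T, ObjectProperty.le_retractClosure _ _ h₀⟩
      isStableUnderShiftBy := fun n =>
        { le_shift := by
            rintro z ⟨z', hz', ⟨r⟩⟩
            exact ⟨z'⟦n⟧, (I.extensionProduct J).le_shift n _ hz',
              ⟨r.map (shiftFunctor T n)⟩⟩ }
      toIsTriangulatedClosed₂ := h₂ }

end Orthogonal

/-! ### Exactness and completion of morphisms for triangles written out by their maps -/

section Triangles

variable {T : Type u} [Category.{v} T] [Preadditive T] [HasZeroObject T] [HasShift T ℤ]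
  [∀ n : ℤ, (shiftFunctor T n).Additive] [Pretriangulated T]

variable {a b c a' b' c' x : T} {f : a ⟶ b} {g : b ⟶ c} {h : c ⟶ a⟦(1 : ℤ)⟧}
  {f' : a' ⟶ b'} {g' : b' ⟶ c'} {h' : c' ⟶ a'⟦(1 : ℤ)⟧}

lemma distTriang_comp₁₂ (hT : Triangle.mk f g h ∈ distTriang T) : f ≫ g = 0 :=
  comp_distTriang_mor_zero₁₂ _ hT

lemma distTriang_comp₃₁ (hT : Triangle.mk f g h ∈ distTriang T) : h ≫ f⟦(1 : ℤ)⟧' = 0 :=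
  comp_distTriang_mor_zero₃₁ _ hT

lemma distTriang_desc₂ (hT : Triangle.mk f g h ∈ distTriang T) (k : b ⟶ x) (hk : f ≫ k = 0) :
    ∃ l : c ⟶ x, k = g ≫ l :=
  Triangle.yoneda_exact₂ _ hT k hk

lemma distTriang_desc₃ (hT : Triangle.mk f g h ∈ distTriang T) (k : c ⟶ x) (hk : g ≫ k = 0) :
    ∃ l : a⟦(1 : ℤ)⟧ ⟶ x, k = h ≫ l :=
  Triangle.yoneda_exact₃ _ hT k hk

lemma distTriang_hom₁ (hT : Triangle.mk f g h ∈ distTriang T)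
    (hT' : Triangle.mk f' g' h' ∈ distTriang T) (β : b ⟶ b') (γ : c ⟶ c')
    (comm : g ≫ γ = β ≫ g') :
    ∃ α : a ⟶ a', f ≫ β = α ≫ f' ∧ h ≫ α⟦(1 : ℤ)⟧' = γ ≫ h' :=
  complete_distinguished_triangle_morphism₁ _ _ hT hT' β γ comm

lemma distTriang_hom₂ (hT : Triangle.mk f g h ∈ distTriang T)
    (hT' : Triangle.mk f' g' h' ∈ distTriang T) (α : a ⟶ a') (γ : c ⟶ c')
    (comm : h ≫ α⟦(1 : ℤ)⟧' = γ ≫ h') :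
    ∃ β : b ⟶ b', f ≫ β = α ≫ f' ∧ g ≫ γ = β ≫ g' :=
  complete_distinguished_triangle_morphism₂ _ _ hT hT' α γ comm

lemma distTriang_isIso₂ (hT : Triangle.mk f g h ∈ distTriang T) (β : b ⟶ b)
    (h₁ : f ≫ β = f) (h₂ : β ≫ g = g) : IsIso β :=
  isIso₂_of_isIso₁₃ (Triangle.homMk (Triangle.mk f g h) (Triangle.mk f g h) (𝟙 a) β (𝟙 c)
    (h₁.trans (Category.id_comp f).symm) ((Category.comp_id g).trans h₂.symm)
    (((congrArg (h ≫ ·) (CategoryTheory.Functor.map_id _ _)).trans (Category.comp_id h)).trans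
      (Category.id_comp h).symm)) hT hT
    (inferInstanceAs (IsIso (𝟙 a))) (inferInstanceAs (IsIso (𝟙 c)))

lemma distTriang_of_iso₂ (hT : Triangle.mk f g h ∈ distTriang T) (e : b ≅ b') :
    Triangle.mk (f ≫ e.hom) (e.inv ≫ g) h ∈ distTriang T :=
  isomorphic_distinguished _ hT _ (Triangle.isoMk _ _ (Iso.refl _) e.symm (Iso.refl _)
    (show (f ≫ e.hom) ≫ e.inv = 𝟙 _ ≫ f by simp)
    (show (e.inv ≫ g) ≫ 𝟙 _ = e.inv ≫ g by simp)
    (show h ≫ (𝟙 a)⟦(1 : ℤ)⟧' = 𝟙 _ ≫ h by simp))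

end Triangles

/-! ### Abstract Mayer-Vietoris for two orthogonal subcategories -/

section MayerVietoris

variable {T : Type u} [Category.{v} T] [Preadditive T] [HasZeroObject T] [HasShift T ℤ]
  [∀ n : ℤ, (shiftFunctor T n).Additive] [Pretriangulated T]
  {I J : ObjectProperty T} [I.IsTriangulated] [I.IsClosedUnderIsomorphisms]
  [J.IsTriangulated] [J.IsClosedUnderIsomorphisms]

/-- The obstruction is a map to `x` from the fibre of `t`, which lies in `J`. -/
lemma exists_extension_of_trW (h : HomZero J I) {a b x : T} {t : a ⟶ b} (ht : J.trW t)
    (hx : I x) (f : a ⟶ x) : ∃ g : b ⟶ x, t ≫ g = f := by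
  rw [ObjectProperty.trW_iff'] at ht
  obtain ⟨y, k, l, hT, hy⟩ := ht
  obtain ⟨g, hg⟩ := distTriang_desc₂ hT f (h hy hx _)
  exact ⟨g, hg.symm⟩

lemma FactorsThrough.extend (h : HomZero J I) {a b c : T} {t : a ⟶ b} (ht : J.trW t)
    {f : a ⟶ c} (hf : FactorsThrough I f) :
    ∃ g : b ⟶ c, FactorsThrough I g ∧ t ≫ g = f := by
  obtain ⟨x, hx, u, w, rfl⟩ := hf
  obtain ⟨u', rfl⟩ := exists_extension_of_trW h ht hx u
  exact ⟨u' ≫ w, ⟨x, hx, u', w, rfl⟩, by simp⟩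

lemma FactorsThrough.exists_trW {a b : T} {f : a ⟶ b} (hf : FactorsThrough I f) :
    ∃ (a' : T) (s : a' ⟶ a), I.trW s ∧ s ≫ f = 0 := by
  obtain ⟨x, hx, u, w, rfl⟩ := hf
  obtain ⟨a', s, k, hT⟩ := distinguished_cocone_triangle₁ u
  refine ⟨a', s, ⟨_, _, _, hT, hx⟩, ?_⟩
  rw [← Category.assoc, distTriang_comp₁₂ hT, zero_comp]

lemma trW_neg {P : ObjectProperty T} {a b : T} {f : a ⟶ b} (h : P.trW (-f)) : P.trW f := by
  have := (P.smul_mem_trW_iff f (-1)).1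
  apply this
  simpa using h

/-- The octahedral axiom for `biprod.inl ≫ d` identifies its cone, up to shift and sign, with that
of `i ≫ biprod.snd`: opposite sides of the homotopy pullback square have the same cone. -/
lemma trW_comp_snd [IsTriangulated T] {a₁ a₂ a₃ a : T} {i : a₃ ⟶ a₁ ⊞ a₂} {d : a₁ ⊞ a₂ ⟶ a}
    {δ : a ⟶ a₃⟦(1 : ℤ)⟧} (hT : Triangle.mk i d δ ∈ distTriang T)
    (h : I.trW (biprod.inl ≫ d)) : I.trW (i ≫ biprod.snd) := by
  obtain ⟨x, g, k, hx, hI⟩ := h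
  have o := Triangulated.someOctahedron rfl (binaryBiproductTriangle_distinguished a₁ a₂)
    (rot_of_distTriang _ hT) hx
  have h₁ : I.trW ((-(i⟦(1 : ℤ)⟧')) ≫ (biprod.snd : a₁ ⊞ a₂ ⟶ a₂)⟦(1 : ℤ)⟧') :=
    (I.trW_iff_of_distinguished' _ (rot_of_distTriang _ o.mem)).2 hI
  rw [Preadditive.neg_comp, ← Functor.map_comp] at h₁
  exact (trW_neg h₁).unshift

lemma trW_comp_fst [IsTriangulated T] {a₁ a₂ a₃ a : T} {i : a₃ ⟶ a₁ ⊞ a₂} {d : a₁ ⊞ a₂ ⟶ a}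
    {δ : a ⟶ a₃⟦(1 : ℤ)⟧} (hT : Triangle.mk i d δ ∈ distTriang T)
    (h : J.trW (biprod.inr ≫ d)) : J.trW (i ≫ biprod.fst) := by
  have := trW_comp_snd (I := J) (distTriang_of_iso₂ hT (biprod.braiding a₁ a₂))
    (by convert h using 1; simp [biprod.lift_eq])
  convert this using 1
  simp

/-- The Mayer-Vietoris triangle of morphisms `s : a₁ ⟶ a` and `t : a₂ ⟶ a`. -/
lemma exists_mayerVietoris_triangle [IsTriangulated T] {a a₁ a₂ : T} {s : a₁ ⟶ a} {t : a₂ ⟶ a}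
    (hs : I.trW s) (ht : J.trW t) :
    ∃ (a₃ : T) (i : a₃ ⟶ a₁ ⊞ a₂) (δ : a ⟶ a₃⟦(1 : ℤ)⟧),
      Triangle.mk i (biprod.desc s (-t)) δ ∈ distTriang T ∧
        J.trW (i ≫ biprod.fst) ∧ I.trW (i ≫ biprod.snd) := by
  obtain ⟨a₃, i, δ, hT⟩ := distinguished_cocone_triangle₁ (biprod.desc s (-t))
  exact ⟨a₃, i, δ, hT, trW_comp_fst hT (by simpa using trW_neg (f := -t) (by simpa using ht)),
    trW_comp_snd hT (by simpa using hs)⟩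

/-- With `I`, `J` the objects vanishing on `U`, `V`, the maps `g₁`, `g₂` are numerators of morphisms
on `U` and `V`, and `hd` encodes their agreement on `U ∩ V`. -/
lemma exists_glued_hom [IsTriangulated T] (hIJ : HomZero I J) (hJI : HomZero J I)
    {a a₁ a₂ b : T} {s : a₁ ⟶ a} {t : a₂ ⟶ a} (hs : I.trW s) (ht : J.trW t)
    (g₁ : a₁ ⟶ b) (g₂ : a₂ ⟶ b)
    (hd : ∀ (a₃ : T) (t' : a₃ ⟶ a₁) (s' : a₃ ⟶ a₂), J.trW t' → I.trW s' → t' ≫ s = s' ≫ t →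
      Decomposes I J (t' ≫ g₁ - s' ≫ g₂)) :
    ∃ h : a ⟶ b, FactorsThrough I (s ≫ h - g₁) ∧ FactorsThrough J (t ≫ h - g₂) := by
  obtain ⟨a₃, i, δ, hT, hi₁, hi₂⟩ := exists_mayerVietoris_triangle hs ht
  have comm : (i ≫ biprod.fst) ≫ s = (i ≫ biprod.snd) ≫ t := by
    have h := distTriang_comp₁₂ hT
    rw [biprod.desc_eq] at h
    simp only [Preadditive.comp_add, Preadditive.comp_neg] at h
    simpa [← sub_eq_add_neg, sub_eq_zero] using h
  obtain ⟨d₁, d₂, h₁, h₂, hd⟩ := hd a₃ _ _ hi₁ hi₂ comm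
  -- The `I`-part of the discrepancy extends to `a₁` and the `J`-part to `a₂`; correcting `g₁` and
  -- `g₂` by these extensions makes them agree exactly on `a₃`.
  obtain ⟨e₁, he₁, rfl⟩ := h₁.extend hJI hi₁
  obtain ⟨e₂, he₂, rfl⟩ := h₂.extend hIJ hi₂
  have h0 : i ≫ biprod.desc (g₁ - e₁) (-(g₂ + e₂)) = 0 := by
    rw [biprod.desc_eq]
    simp only [Preadditive.comp_add, Preadditive.comp_sub, Preadditive.comp_neg,
      Category.assoc] at hd ⊢
    rw [sub_eq_iff_eq_add.1 hd]
    abel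
  obtain ⟨h, hh⟩ := distTriang_desc₂ hT _ h0
  have hs' : g₁ - e₁ = s ≫ h := by simpa using congrArg (fun f => biprod.inl ≫ f) hh
  have ht' : g₂ + e₂ = t ≫ h := by
    have := congrArg (fun f => -(biprod.inr ≫ f)) hh
    simpa only [biprod.inr_desc, biprod.inr_desc_assoc, Preadditive.neg_comp, neg_neg] using this
  refine ⟨h, ?_, ?_⟩
  · rw [← hs']
    obtain ⟨x, hx, u, w, rfl⟩ := he₁
    exact ⟨x, hx, -u, w, by simp⟩
  · rw [← ht']
    simpa using he₂

/-- Since `f` dies on both pieces, it is `δ ≫ g` for the connecting map `δ`. Up to `p` and `q`, the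
map `g` decomposes into parts that extend along the maps out of the corner of the square, and such
parts are killed by the connecting map. -/
lemma eq_zero_of_factorsThrough [IsTriangulated T] (hIJ : HomZero I J) (hJI : HomZero J I)
    {a b : T} {f : a ⟶ b} {p : a ⟶ a} {q : b ⟶ b} (hp : p ≫ f = f) (hq : f ≫ q = f)
    (hI : FactorsThrough I f) (hJ : FactorsThrough J f)
    (hd : ∀ (a₁ a₁' a₃ a₃' : T) (e₁ : a₃ ⟶ a₁) (e₂ : a₁ ⟶ a) (e₁' : a₃' ⟶ a₁') (e₂' : a₁' ⟶ a)
      (ρ : a₃' ⟶ a₃) (g : a₃⟦(1 : ℤ)⟧ ⟶ b), J.trW e₁ → I.trW e₂ → J.trW e₁' → I.trW e₂' →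
      ρ ≫ e₁ ≫ e₂ = (e₁' ≫ e₂') ≫ p → Decomposes I J (ρ⟦(1 : ℤ)⟧' ≫ g ≫ q)) : f = 0 := by
  obtain ⟨a₁, s, hs, hs0⟩ := hI.exists_trW
  obtain ⟨a₂, t, ht, ht0⟩ := hJ.exists_trW
  -- The endomorphism `p` need not lift to the triangle of `s` and `t`. Ore squares give a second
  -- triangle over `a` and a morphism `ρ` of the corners that covers `p`.
  obtain ⟨φ, hφ⟩ := (MorphismProperty.LeftFraction.mk p s hs).exists_rightFraction
  obtain ⟨ψ, hψ⟩ := (MorphismProperty.LeftFraction.mk p t ht).exists_rightFraction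
  dsimp at hφ hψ
  obtain ⟨a₃, i, δ, hT, hi₁, hi₂⟩ := exists_mayerVietoris_triangle hs ht
  obtain ⟨a₃', i', δ', hT', hi₁', hi₂'⟩ := exists_mayerVietoris_triangle φ.hs ψ.hs
  obtain ⟨g, hg⟩ := distTriang_desc₃ hT f (by
    ext
    · simpa using hs0
    · simpa using ht0)
  obtain ⟨ρ, hρ₁, hρ₂⟩ := distTriang_hom₁ hT' hT
    (biprod.map φ.f ψ.f) p (by ext <;> simp [hφ, hψ])
  obtain ⟨d₁, d₂, h₁, h₂, hd⟩ := hd a₁ φ.X' a₃ a₃' (i ≫ biprod.fst) s (i' ≫ biprod.fst) φ.s ρ g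
    hi₁ hs hi₁' φ.hs (by
      have := congrArg (fun f => f ≫ biprod.fst ≫ s) hρ₁
      simp only [Category.assoc, biprod.map_fst_assoc] at this ⊢
      rw [← this, hφ])
  have key : f = δ' ≫ d₁ + δ' ≫ d₂ := by
    rw [← Preadditive.comp_add, ← hd, ← Category.assoc, hρ₂, Category.assoc, ← Category.assoc δ,
      ← hg, hq, hp]
  have z := distTriang_comp₃₁ hT'
  obtain ⟨e₁, -, rfl⟩ := h₁.extend hJI (hi₁'.shift 1)
  obtain ⟨e₂, -, rfl⟩ := h₂.extend hIJ (hi₂'.shift 1)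
  rw [key]
  simp only [Functor.map_comp, Category.assoc]
  rw [← Category.assoc δ', z, ← Category.assoc δ', z]
  simp

/-- Retracts of extensions: a retract diagram on the third objects of two distinguished triangles
with the same first object yields one on the second objects. -/
lemma exists_retract_of_triangles {w c m x z : T} {j : w ⟶ c} {l : c ⟶ m} {k : m ⟶ w⟦(1 : ℤ)⟧}
    {r : w ⟶ x} {l' : x ⟶ z} {k' : z ⟶ w⟦(1 : ℤ)⟧} (hT : Triangle.mk j l k ∈ distTriang T)
    (hT' : Triangle.mk r l' k' ∈ distTriang T) (φ : m ⟶ z) (ψ : z ⟶ m)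
    (hφ : φ ≫ k' = k) (hψ : ψ ≫ k = k') (h : ψ ≫ φ = 𝟙 z) :
    ∃ (f : c ⟶ x) (f' : x ⟶ c), f' ≫ f = 𝟙 x ∧ j ≫ f = r := by
  obtain ⟨f, hf₁, hf₂⟩ := distTriang_hom₂ hT hT' (𝟙 w) φ
    (by simp [hφ])
  obtain ⟨f', hf₁', hf₂'⟩ := distTriang_hom₂ hT' hT (𝟙 w) ψ
    (by simp [hψ])
  rw [Category.id_comp] at hf₁ hf₁'
  -- The lifts compose only to an automorphism, the identity on the outer terms; its inverse is
  -- absorbed into `f'`.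
  have : IsIso (f' ≫ f) := distTriang_isIso₂ hT' _ (by rw [← Category.assoc, hf₁', hf₁])
    (by rw [Category.assoc, ← hf₂, ← Category.assoc, ← hf₂', Category.assoc, h,
      Category.comp_id])
  exact ⟨f, inv (f' ≫ f) ≫ f', by simp, hf₁⟩

end MayerVietoris

/-! ### Thick tensor ideals, primes and rigidity -/

section Ideals

variable {K : Type u} [Category.{v} K] [Preadditive K] [HasZeroObject K] [HasShift K ℤ]
  [∀ n : ℤ, (shiftFunctor K n).Additive] [Pretriangulated K]

/-- A retract in a pretriangulated category is a direct summand. -/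
lemma exists_iso_biprod_of_retract {a b : K} (r : Retract a b) :
    ∃ c, Nonempty (b ≅ a ⊞ c) := by
  obtain ⟨c, g, h, hT⟩ := distinguished_cocone_triangle r.i
  obtain ⟨e, -⟩ := exists_iso_binaryBiproduct_of_distTriang _ hT
    (Triangle.mor₃_eq_zero_of_mono₁ _ hT (inferInstanceAs (Mono r.i)))
  exact ⟨c, ⟨e⟩⟩

instance isZero_isTriangulated : ObjectProperty.IsTriangulated (IsZero : ObjectProperty K) where
  exists_zero := ⟨_, isZero_zero K, isZero_zero K⟩
  isStableUnderShiftBy n := { le_shift := fun _ h => (shiftFunctor K n).map_isZero h }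
  ext₂' t ht h₁ h₃ := ⟨_, Triangle.isZero₂_of_isZero₁₃ t ht h₁ h₃, ⟨Iso.refl _⟩⟩

lemma isZero_isStableUnderRetracts :
    ObjectProperty.IsStableUnderRetracts (IsZero : ObjectProperty K) where
  of_retract r h := (IsZero.iff_id_eq_zero _).2 (by
    rw [← r.retract, h.eq_of_tgt r.i 0, zero_comp])

variable [MonoidalCategory K]

/-- Thick triangulated tensor ideals. -/
structure IsThickIdeal (P : ObjectProperty K) : Prop where
  triangulated : P.IsTriangulated
  retracts : P.IsStableUnderRetracts
  ideal (a b : K) : P a → P (a ⊗ b)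

lemma Spc.isThickIdeal (p : Spc K) : IsThickIdeal p.carrier where
  triangulated := p.isTriangulated
  retracts :=
    ⟨fun {a b} r hb => by
      obtain ⟨c, ⟨e⟩⟩ := exists_iso_biprod_of_retract r
      have := p.isClosedUnderIsomorphisms
      exact (p.thick a c (p.carrier.prop_of_iso e hb)).1⟩
  ideal := p.ideal

lemma isThickIdeal_supportedOn (Z : Set (Spc K)) : IsThickIdeal (supportedOn Z) where
  triangulated := inferInstance
  retracts := ⟨fun {a b} r hb => by
    rw [supportedOn_iff] at hb ⊢
    intro P hP
    have := P.isThickIdeal.retracts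
    exact P.carrier.prop_of_retract r (hb P hP)⟩
  ideal a b ha := by
    rw [supportedOn_iff] at ha ⊢
    exact fun P hP => P.ideal a b (ha P hP)

lemma IsThickIdeal.isClosedUnderIsomorphisms {P : ObjectProperty K} (h : IsThickIdeal P) :
    P.IsClosedUnderIsomorphisms := by
  have := h.retracts
  infer_instance

variable [TensorTriangulated K]

lemma isThickIdeal_isZero : IsThickIdeal (IsZero : ObjectProperty K) where
  triangulated := isZero_isTriangulated
  retracts := isZero_isStableUnderRetracts
  ideal a b ha := by
    let _ := TensorTriangulated.commShiftRight b
    have := TensorTriangulated.exactRight b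
    exact (tensorRight b).map_isZero ha

section Symmetric

variable [SymmetricCategory K]

/-- The colon ideal of objects `z` with `z ⊗ b` in `P`. -/
lemma IsThickIdeal.colon {P : ObjectProperty K} (h : IsThickIdeal P) (b : K) :
    IsThickIdeal (P.inverseImage (tensorRight b)) := by
  let _ := TensorTriangulated.commShiftRight b
  have := TensorTriangulated.exactRight b
  have := h.triangulated
  have := h.retracts
  refine ⟨inferInstance, ⟨fun r hb => P.prop_of_retract (r.map (tensorRight b)) hb⟩, ?_⟩
  intro a c ha
  exact P.prop_of_iso (α_ a b c ≪≫ whiskerLeftIso a (β_ b c) ≪≫ (α_ a c b).symm)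
    (h.ideal (a ⊗ b) c ha)

lemma IsThickIdeal.le_colon {P : ObjectProperty K} (h : IsThickIdeal P) (b : K) :
    P ≤ P.inverseImage (tensorRight b) := fun a ha => h.ideal a b ha

lemma IsThickIdeal.prop_tensor_comm {P : ObjectProperty K} (h : IsThickIdeal P) {a b : K}
    (hab : P (a ⊗ b)) : P (b ⊗ a) := by
  have := h.retracts
  exact P.prop_of_iso (β_ a b) hab

/-- A thick ideal that is disjoint from a multiplicative class of objects is contained in a prime
ideal that is disjoint from this class. -/
lemma exists_prime_of_disjoint {P M : ObjectProperty K} (hP : IsThickIdeal P)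
    (hne : ∃ a, M a) (hM : ∀ a b, M a → M b → M (a ⊗ b)) (hPM : ∀ a, M a → ¬ P a) :
    ∃ p : Spc K, P ≤ p.carrier ∧ ∀ a, M a → ¬ p.carrier a := by
  obtain ⟨Q, hPQ, hQ⟩ := zorn_le_nonempty₀
    {Q : ObjectProperty K | IsThickIdeal Q ∧ ∀ a, M a → ¬ Q a} (by
      intro c hc hchain Q₀ hQ₀
      have hcl : (∀ R ∈ c, R.IsClosedUnderIsomorphisms) := fun R hR =>
        (hc hR).1.isClosedUnderIsomorphisms
      refine ⟨fun a => ∃ R ∈ c, R a, ⟨⟨?_, ⟨?_⟩, ?_⟩, ?_⟩, fun R hR a ha => ⟨R, hR, ha⟩⟩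
      · have h₀ := (hc hQ₀).1.triangulated
        have := hcl _ hQ₀
        exact
          { exists_zero := ⟨_, isZero_zero K, Q₀, hQ₀, Q₀.prop_zero⟩
            isStableUnderShiftBy := fun n =>
              { le_shift := by
                  rintro a ⟨R, hR, ha⟩
                  have := (hc hR).1.triangulated
                  exact ⟨R, hR, R.le_shift n _ ha⟩ }
            ext₂' := by
              rintro t ht ⟨R₁, hR₁, h₁⟩ ⟨R₃, hR₃, h₃⟩
              refine ⟨_, ?_, ⟨Iso.refl _⟩⟩
              obtain ⟨R, hR, h₁, h₃⟩ : ∃ R ∈ c, R t.obj₁ ∧ R t.obj₃ := by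
                rcases hchain.total hR₁ hR₃ with h | h
                · exact ⟨R₃, hR₃, h _ h₁, h₃⟩
                · exact ⟨R₁, hR₁, h₁, h _ h₃⟩
              have := (hc hR).1.triangulated
              have := hcl _ hR
              exact ⟨R, hR, R.ext_of_isTriangulatedClosed₂ t ht h₁ h₃⟩ }
      · rintro a b r ⟨R, hR, hb⟩
        have := (hc hR).1.retracts
        exact ⟨R, hR, R.prop_of_retract r hb⟩
      · rintro a b ⟨R, hR, ha⟩
        exact ⟨R, hR, (hc hR).1.ideal a b ha⟩
      · rintro a ha ⟨R, hR, h⟩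
        exact (hc hR).2 a ha h) P ⟨hP, hPM⟩
  have hQi := hQ.prop.1
  -- The colon ideal of `b` contains `Q` and also `c`, so by maximality it meets `M`. Using this for
  -- both tensor factors puts an element of `M` into `Q`.
  have meets : ∀ b c, Q (c ⊗ b) → ¬ Q c → ∃ m, M m ∧ Q (m ⊗ b) := by
    intro b c hcb hc
    by_contra! h
    exact hc (hQ.le_of_ge ⟨hQi.colon b, h⟩ (hQi.le_colon b) c hcb)
  have := hQi.retracts
  refine ⟨⟨Q, hQi.isClosedUnderIsomorphisms, hQi.triangulated, fun a b h =>
    ⟨ObjectProperty.IsStableUnderRetracts.of_biprod_left Q h,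
      ObjectProperty.IsStableUnderRetracts.of_biprod_right Q h⟩, hQi.ideal, ?_, ?_⟩, hPQ,
      hQ.prop.2⟩
  · intro b c hbc
    by_contra! h
    obtain ⟨m, hm, hmc⟩ := meets c b hbc h.1
    obtain ⟨m', hm', hmm⟩ := meets m c (hQi.prop_tensor_comm hmc) h.2
    exact hQ.prop.2 _ (hM _ _ hm' hm) hmm
  · obtain ⟨a, ha⟩ := hne
    exact ⟨a, hQ.prop.2 a ha⟩

variable [MonoidalClosed K] [StronglyClosed K]

/-- Every morphism `a ⟶ b` factors through `a ⊗ (D a ⊗ b)`. -/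
lemma exists_factorization_dual {a b : K} (f : a ⟶ b) :
    ∃ (u : a ⟶ a ⊗ (dual a ⊗ b)) (w : a ⊗ (dual a ⊗ b) ⟶ b), u ≫ w = f := by
  have := StronglyClosed.isIso_dualTensorHom a b
  let g : 𝟙_ K ⟶ (ihom a).obj b := MonoidalClosed.curry ((ρ_ a).hom ≫ f)
  refine ⟨(ρ_ a).inv ≫ a ◁ (g ≫ inv (dualTensorHom a b)),
    a ◁ dualTensorHom a b ≫ (ihom.ev a).app b, ?_⟩
  have h : a ◁ g ≫ (ihom.ev a).app b = (ρ_ a).hom ≫ f := by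
    rw [← MonoidalClosed.uncurry_eq, MonoidalClosed.uncurry_curry]
  rw [Category.assoc, ← Category.assoc (a ◁ _), ← MonoidalCategory.whiskerLeft_comp,
    Category.assoc, IsIso.inv_hom_id, Category.comp_id, h, Iso.inv_hom_id_assoc]

/-- By rigidity `a` is a retract of `a ⊗ (D a ⊗ a)`, so `a ⊗ c` is a retract of `a ⊗ (a ⊗ c) ⊗ D a`.
-/
lemma IsThickIdeal.radical {P : ObjectProperty K} (h : IsThickIdeal P) {a c : K}
    (hac : P (a ⊗ (a ⊗ c))) : P (a ⊗ c) := by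
  obtain ⟨u, w, huw⟩ := exists_factorization_dual (𝟙 a)
  have := (h.colon c).retracts
  refine (P.inverseImage (tensorRight c)).prop_of_retract (⟨u, w, huw⟩ : Retract a _) ?_
  have := h.retracts
  refine P.prop_of_iso ?_ (h.ideal _ (dual a) hac)
  exact α_ a (a ⊗ c) (dual a) ≪≫ whiskerLeftIso a
    (β_ (a ⊗ c) (dual a) ≪≫ (α_ (dual a) a c).symm) ≪≫ (α_ a (dual a ⊗ a) c).symm

/-- A thick ideal that contains `b` contains all objects that are supported on `supp b`. -/
lemma IsThickIdeal.prop_of_supp_subset {P : ObjectProperty K} (h : IsThickIdeal P) {b z : K}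
    (hb : P b) (hz : supp z ⊆ supp b) : P z := by
  have := h.retracts
  by_contra hPz
  -- This class contains `z`, is multiplicative by radicality, and misses `P` (take `c = 𝟙`). The
  -- prime obtained contains `b` but not `z`.
  obtain ⟨p, hp, hpM⟩ := exists_prime_of_disjoint (M := fun m => ∀ c, P (m ⊗ c) → P (z ⊗ c)) h
    ⟨z, fun _ h => h⟩ (by
      intro m m' hm hm' c hc
      have h₁ := hm _ (P.prop_of_iso (α_ m m' c) hc)
      have h₂ := hm' (z ⊗ c) (P.prop_of_iso ((α_ z m' c).symm ≪≫ whiskerRightIso (β_ z m') c ≪≫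
        α_ m' z c) h₁)
      exact h.radical h₂) (fun m hm hPm => hPz
        (P.prop_of_iso (ρ_ z) (hm (𝟙_ K) (h.ideal _ _ hPm))))
  exact hz (hpM z fun _ h => h) (hp b hb)

lemma isZero_of_supp_eq_empty {z : K} (hz : supp z = ∅) : IsZero z :=
  isThickIdeal_isZero.prop_of_supp_subset (isZero_zero K) (by simp [hz])

/-- The object `a ⊗ (D a ⊗ b)` lies in every prime that contains `a` or `b`. -/
lemma factorsThrough_supportedOn_inter {Z₁ Z₂ : Set (Spc K)} {a b : K} (ha : supportedOn Z₁ a)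
    (hb : supportedOn Z₂ b) (f : a ⟶ b) : FactorsThrough (supportedOn (Z₁ ∩ Z₂)) f := by
  obtain ⟨u, w, h⟩ := exists_factorization_dual f
  refine ⟨_, ?_, u, w, h⟩
  rw [supportedOn_iff] at ha hb ⊢
  intro P hP
  by_cases h₁ : P ∈ Z₁
  · have h₂ := hb P fun h₂ => hP ⟨h₁, h₂⟩
    have hi := P.isThickIdeal
    exact hi.prop_tensor_comm (hi.ideal _ a (hi.prop_tensor_comm (hi.ideal b (dual a) h₂)))
  · exact P.ideal a _ (ha P h₁)

end Symmetric

end Ideals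

/-! ### Supports and quasi-compact open subsets -/

section Spectrum

variable {K : Type u} [Category.{v} K] [Preadditive K] [HasZeroObject K] [HasShift K ℤ]
  [∀ n : ℤ, (shiftFunctor K n).Additive] [Pretriangulated K] [MonoidalCategory K]

lemma supp_biprod (a b : K) : supp (a ⊞ b) = supp a ∪ supp b := by
  ext P
  have := P.isClosedUnderIsomorphisms
  have := P.isTriangulated
  simp only [supp, Set.mem_ofPred_eq, Set.mem_union, ← not_and_or, not_iff_not]
  exact ⟨P.thick a b, fun h => P.carrier.ext_of_isTriangulatedClosed₂ _
    (binaryBiproductTriangle_distinguished a b) h.1 h.2⟩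

lemma isOpen_compl_supp (a : K) : IsOpen (supp a)ᶜ :=
  TopologicalSpace.isOpen_generateFrom_of_mem ⟨a, rfl⟩

variable [SymmetricCategory K] [TensorTriangulated K]

lemma supp_tensor (a b : K) : supp (a ⊗ b) = supp a ∩ supp b := by
  ext P
  simp only [supp, Set.mem_ofPred_eq, Set.mem_inter_iff, ← not_or, not_iff_not]
  exact ⟨P.prime a b, fun h => h.elim (P.ideal a b) fun h =>
    P.isThickIdeal.prop_tensor_comm (P.ideal b a h)⟩

lemma supp_unit : supp (𝟙_ K) = Set.univ := by
  ext P
  simp only [Set.mem_univ, iff_true]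
  intro h
  obtain ⟨a, ha⟩ := P.proper
  have := P.isClosedUnderIsomorphisms
  exact ha (P.carrier.prop_of_iso (λ_ a) (P.ideal _ a h))

/-- Direct sums close the generating sets under intersection, so these form a basis. -/
lemma exists_compl_supp_of_mem {U : Set (Spc K)} (hU : IsOpen U) {P : Spc K} (hP : P ∈ U) :
    ∃ a : K, P ∈ (supp a)ᶜ ∧ (supp a)ᶜ ⊆ U := by
  induction hU with
  | basic s hs =>
    obtain ⟨a, rfl⟩ := hs
    exact ⟨a, hP, le_rfl⟩
  | univ =>
    have := P.isClosedUnderIsomorphisms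
    have := P.isTriangulated
    obtain ⟨z, -, hz⟩ := P.carrier.exists_prop_of_containsZero
    exact ⟨z, fun h => h hz, Set.subset_univ _⟩
  | inter s t _ _ hs ht =>
    obtain ⟨a, ha, ha'⟩ := hs hP.1
    obtain ⟨b, hb, hb'⟩ := ht hP.2
    refine ⟨a ⊞ b, ?_, ?_⟩
    · rw [supp_biprod, Set.compl_union]
      exact ⟨ha, hb⟩
    · rw [supp_biprod, Set.compl_union]
      exact Set.inter_subset_inter ha' hb'
  | sUnion S _ h =>
    obtain ⟨s, hs, hPs⟩ := hP
    obtain ⟨a, ha, ha'⟩ := h s hs hPs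
    exact ⟨a, ha, ha'.trans (Set.subset_sUnion_of_mem hs)⟩

/-- A quasi-compact open subset is the complement of the support of an object. -/
lemma exists_compl_eq_supp {U : Opens (Spc K)} (hU : IsCompact (U : Set (Spc K))) :
    ∃ b : K, (U : Set (Spc K))ᶜ = supp b := by
  obtain ⟨b, h₁, h₂⟩ := hU.induction_on
    (p := fun s => ∃ b : K, s ⊆ (supp b)ᶜ ∧ (supp b)ᶜ ⊆ (U : Set (Spc K)))
    ⟨𝟙_ K, Set.empty_subset _, by simp [supp_unit]⟩
    (fun s t hst ⟨b, h₁, h₂⟩ => ⟨b, hst.trans h₁, h₂⟩)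
    (fun s t ⟨b, h₁, h₂⟩ ⟨c, h₁', h₂'⟩ => ⟨b ⊗ c, by
      rw [supp_tensor, Set.compl_inter]
      exact ⟨Set.union_subset_union h₁ h₁', Set.union_subset h₂ h₂'⟩⟩)
    (fun P hP => by
      obtain ⟨b, hb, hbU⟩ := exists_compl_supp_of_mem U.isOpen hP
      exact ⟨_, mem_nhdsWithin_of_mem_nhds ((isOpen_compl_supp b).mem_nhds hb), b, le_rfl, hbU⟩)
  exact ⟨b, by rw [h₁.antisymm h₂, compl_compl]⟩

/-- By Alexander's subbase theorem only covers by complements of supports matter. If no finite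
subfamily sufficed, the objects whose support has as complement a finite union of members would
avoid the ideal of objects supported on `supp b`; a prime separating the two contains `b` but lies
in no member. -/
lemma isCompact_compl_supp (b : K) : IsCompact (supp b)ᶜ := by
  refine isCompact_generateFrom rfl fun S hS hb => ?_
  by_contra! hcon
  obtain ⟨p, hp, hpM⟩ := exists_prime_of_disjoint
    (M := fun m : K => ∃ Q ⊆ S, Q.Finite ∧ (supp m)ᶜ = ⋃₀ Q) (isThickIdeal_supportedOn (supp b))
    ⟨𝟙_ K, ∅, Set.empty_subset _, Set.finite_empty, by simp [supp_unit]⟩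
    (by
      rintro m m' ⟨Q, hQ, hf, h⟩ ⟨Q', hQ', hf', h'⟩
      exact ⟨Q ∪ Q', Set.union_subset hQ hQ', hf.union hf', by
        rw [supp_tensor, Set.compl_inter, h, h', Set.sUnion_union]⟩)
    (by
      rintro m ⟨Q, hQ, hf, h⟩ hm
      exact hcon Q hQ hf (h ▸ Set.compl_subset_compl.2 hm))
  obtain ⟨s, hs, hps⟩ := hb (show p ∈ (supp b)ᶜ from fun h => h (hp b subset_rfl))
  obtain ⟨a, rfl⟩ := hS hs
  exact hps (hpM a ⟨{(supp a)ᶜ}, by simpa using hs, Set.finite_singleton _, by simp⟩)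

lemma isCompact_inf {U V : Opens (Spc K)} (hU : IsCompact (U : Set (Spc K)))
    (hV : IsCompact (V : Set (Spc K))) : IsCompact ((U ⊓ V : Opens (Spc K)) : Set (Spc K)) := by
  obtain ⟨a, ha⟩ := exists_compl_eq_supp hU
  obtain ⟨b, hb⟩ := exists_compl_eq_supp hV
  have : ((U ⊓ V : Opens (Spc K)) : Set (Spc K)) = (supp (a ⊞ b))ᶜ := by
    rw [supp_biprod, ← ha, ← hb, Set.compl_union, compl_compl, compl_compl]
    rfl
  rw [this]
  exact isCompact_compl_supp _

end Spectrum

/-! ### Morphisms in `L(U)` and their restriction -/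

section Localization

variable {K : Type u} [Category.{v} K] [Preadditive K] [HasZeroObject K] [HasShift K ℤ]
  [∀ n : ℤ, (shiftFunctor K n).Additive] [Pretriangulated K] [IsTriangulated K]
  [MonoidalCategory K]

/-- Morphisms on `U` between objects of `K`. -/
abbrev HomOn (U : Opens (Spc K)) (x y : K) := (uIso U).Q.obj x ⟶ (uIso U).Q.obj y

/-- The image on `U` of a morphism of `K`. -/
noncomputable abbrev onOpen (U : Opens (Spc K)) {x y : K} (f : x ⟶ y) : HomOn U x y :=
  (uIso U).Q.map f

lemma onOpen_comp (U : Opens (Spc K)) {x y z : K} (f : x ⟶ y) (g : y ⟶ z) :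
    onOpen U (f ≫ g) = onOpen U f ≫ onOpen U g :=
  (uIso U).Q.map_comp f g

/-- The restriction to `V` of a morphism on `U`. -/
noncomputable def resHom {U V : Opens (Spc K)} (h : V ≤ U) {x y : K} (f : HomOn U x y) :
    HomOn V x y := (resL h).map f

section

variable {U V W : Opens (Spc K)} (h : V ≤ U) {x y z : K}

lemma resHom_id : resHom h (𝟙 ((uIso U).Q.obj x)) = 𝟙 ((uIso V).Q.obj x) :=
  (resL h).map_id _

@[simp]
lemma resHom_comp (f : HomOn U x y) (g : HomOn U y z) :
    resHom h (f ≫ g) = resHom h f ≫ resHom h g :=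
  (resL h).map_comp f g

@[simp]
lemma resHom_onOpen (f : x ⟶ y) : resHom h (onOpen U f) = onOpen V f := by
  exact (Functor.congr_hom (Q_resL h) f).trans
    ((Category.id_comp _).trans (Category.comp_id _))

@[simp]
lemma resHom_resHom (h' : W ≤ V) (f : HomOn U x y) :
    resHom h' (resHom h f) = resHom (h'.trans h) f := by
  exact ((Functor.congr_hom (resL_comp h h') f).trans
    ((Category.id_comp _).trans (Category.comp_id _))).symm

@[simp]
lemma resHom_self (h : U ≤ U) (f : HomOn U x y) : resHom h f = f := by
  have : resL h = 𝟭 (LU U) := Localization.Construction.uniq _ _ (Q_resL h)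
  exact (Functor.congr_hom this f).trans ((Category.id_comp _).trans (Category.comp_id _))

instance resL_additive : (resL h).Additive := by
  rw [Localization.functor_additive_iff (uIso U).Q (uIso U), Q_resL]
  infer_instance

@[simp]
lemma resHom_add (f g : HomOn U x y) : resHom h (f + g) = resHom h f + resHom h g :=
  (resL h).map_add

@[simp]
lemma resHom_sub (f g : HomOn U x y) : resHom h (f - g) = resHom h f - resHom h g :=
  (resL h).map_sub

noncomputable instance resL_commShift : (resL h).CommShift ℤ :=
  letI : Localization.Lifting (uIso U).Q (uIso U) (uIso V).Q (resL h) := ⟨eqToIso (Q_resL h)⟩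
  Functor.commShiftOfLocalization (uIso U).Q (uIso U) ℤ (uIso V).Q (resL h)

instance resL_isTriangulated : (resL h).IsTriangulated := by
  let _ : Localization.Lifting (uIso U).Q (uIso U) (uIso V).Q (resL h) := ⟨eqToIso (Q_resL h)⟩
  have : NatTrans.CommShift
      (Localization.Lifting.iso (uIso U).Q (uIso U) (uIso V).Q (resL h)).hom ℤ :=
    NatTrans.commShift_iso_hom_of_localization (uIso U).Q (uIso U) ℤ (uIso V).Q (resL h)
  have := Localization.essSurj_mapArrow (uIso U).Q (uIso U)
  exact Functor.isTriangulated_of_precomp_iso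
    (Localization.Lifting.iso (uIso U).Q (uIso U) (uIso V).Q (resL h))

end

lemma exists_eq_Q_obj {U : Opens (Spc K)} (X : LU U) : ∃ x : K, X = (uIso U).Q.obj x :=
  ⟨_, ((Localization.Construction.objEquiv (uIso U)).right_inv X).symm⟩

variable {U : Opens (Spc K)} {x y : K}

lemma exists_roof (f : HomOn U x y) :
    ∃ (x' : K) (s : x' ⟶ x) (g : x' ⟶ y), uIso U s ∧ onOpen U s ≫ f = onOpen U g := by
  obtain ⟨φ, rfl⟩ := Localization.exists_rightFraction (uIso U).Q (uIso U) f
  exact ⟨φ.X', φ.s, φ.f, φ.hs, φ.map_s_comp_map _ _⟩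

lemma isIso_onOpen {f : x ⟶ y} (hf : uIso U f) : IsIso (onOpen U f) :=
  (uIso U).Q_inverts f hf

/-- A zero map into `x` has its cone supported off `U`, and `x` is a summand of that cone. -/
lemma supportedOn_of_isZero (h : IsZero ((uIso U).Q.obj x)) :
    supportedOn (U : Set (Spc K))ᶜ x := by
  have h₀ : onOpen U (𝟙 x) = onOpen U 0 := h.eq_of_src _ _
  obtain ⟨x', s, ⟨c, g, k, hT, hc⟩, hs⟩ :=
    (MorphismProperty.map_eq_iff_precomp (uIso U).Q (uIso U) _ _).1 h₀
  have : Mono g := Triangle.mono₂ _ hT (show s = 0 by simpa using hs)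
  have := isSplitMono_of_mono g
  have := (isThickIdeal_supportedOn (U : Set (Spc K))ᶜ).retracts
  exact (supportedOn (U : Set (Spc K))ᶜ).prop_of_retract
    (⟨g, retraction g, by simp⟩ : Retract x c) hc

lemma isZero_of_supportedOn (h : supportedOn (U : Set (Spc K))ᶜ x) :
    IsZero ((uIso U).Q.obj x) := by
  have h₀ : onOpen U (𝟙 x) = onOpen U 0 :=
    (MorphismProperty.map_eq_iff_precomp (uIso U).Q (uIso U) _ _).2
      ⟨0, 0, ⟨x, 𝟙 x, 0, contractible_distinguished₁ x, h⟩, by simp⟩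
  rw [IsZero.iff_id_eq_zero, ← CategoryTheory.Functor.map_id]
  exact h₀.trans (Functor.map_zero _ _ _)

lemma isZero_iff_supportedOn :
    IsZero ((uIso U).Q.obj x) ↔ supportedOn (U : Set (Spc K))ᶜ x :=
  ⟨supportedOn_of_isZero, isZero_of_supportedOn⟩

lemma exists_factorization_of_onOpen_eq_zero {f : x ⟶ y} (hf : onOpen U f = 0) :
    FactorsThrough (supportedOn (U : Set (Spc K))ᶜ) f := by
  obtain ⟨x', s, ⟨c, g, k, hT, hc⟩, hs⟩ :=
    (MorphismProperty.map_eq_iff_precomp (uIso U).Q (uIso U) f 0).1 (hf.trans (by simp))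
  obtain ⟨l, rfl⟩ := distTriang_desc₂ hT f (by simpa using hs)
  exact ⟨c, hc, g, l, rfl⟩

/-! ### Kernels of restriction: orthogonality and decomposition -/

section Kernels

variable {V W : Opens (Spc K)}

/-- The kernel of the restriction from `U` to `V`. -/
noncomputable abbrev ker (h : V ≤ U) : ObjectProperty (LU U) := (resL h).kernel

lemma ker_Q_obj_iff (h : V ≤ U) : ker h ((uIso U).Q.obj x) ↔ supportedOn (V : Set (Spc K))ᶜ x :=
  isZero_iff_supportedOn (U := V) (x := x)

lemma resHom_eq_zero_of_factorsThrough (h : V ≤ U) {f : HomOn U x y}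
    (hf : FactorsThrough (ker h) f) : resHom h f = 0 := by
  obtain ⟨z, hz, u, w, rfl⟩ := hf
  exact ((resL h).map_comp u w).trans (by rw [hz.eq_of_tgt ((resL h).map u) 0, zero_comp]; rfl)

/-- The numerator of a roof for `f` vanishes on `V`, so it already factors in `K` through an object
supported off `V`. -/
lemma factorsThrough_of_resHom_eq_zero (h : V ≤ U) {f : HomOn U x y} (hf : resHom h f = 0) :
    FactorsThrough (ker h) f := by
  obtain ⟨x', s, g, hs, hsg⟩ := exists_roof f
  have := isIso_onOpen hs
  have h₀ : onOpen V g = 0 := by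
    rw [← resHom_onOpen h, ← hsg, resHom_comp, hf, comp_zero]
  obtain ⟨z, hz, u, w, rfl⟩ := exists_factorization_of_onOpen_eq_zero h₀
  have hf' : f = (inv (onOpen U s) ≫ onOpen U u) ≫ onOpen U w := by
    rw [Category.assoc, ← onOpen_comp, IsIso.eq_inv_comp, hsg]
  exact ⟨(uIso U).Q.obj z, (ker_Q_obj_iff h).2 hz, _, _, hf'.symm⟩

lemma trW_ker_iff (h : V ≤ U) {X Y : LU U} (f : X ⟶ Y) :
    (ker h).trW f ↔ IsIso ((resL h).map f) := by
  obtain ⟨Z, g, k, hT⟩ := distinguished_cocone_triangle f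
  rw [show (ker h).trW f ↔ _ from (ker h).trW_iff_of_distinguished _ hT]
  exact Triangle.isZero₃_iff_isIso₁ _ ((resL h).map_distinguished _ hT)

variable [SymmetricCategory K] [TensorTriangulated K] [MonoidalClosed K] [StronglyClosed K]

/-- A roof has a source that still vanishes on `U`, so its numerator factors in `K` through an
object supported off `U ∪ V = W`. -/
lemma homZero_ker (hU : U ≤ W) (hV : V ≤ W) (hW : W = U ⊔ V) :
    HomZero (ker hU) (ker hV) := by
  intro X Y hX hY f
  obtain ⟨x, rfl⟩ := exists_eq_Q_obj X
  obtain ⟨y, rfl⟩ := exists_eq_Q_obj Y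
  rw [ker_Q_obj_iff] at hX hY
  obtain ⟨x', s, g, hs, hsg⟩ := exists_roof f
  have := isIso_onOpen hs
  obtain ⟨c, k, l, hT, hc⟩ := hs
  have hx' : supportedOn (U : Set (Spc K))ᶜ x' :=
    ObjectProperty.ext_of_isTriangulatedClosed₁ _ _ hT hX
      (supportedOn_mono (Set.compl_subset_compl.2 hU) _ hc)
  obtain ⟨z, hz, u, w, rfl⟩ := factorsThrough_supportedOn_inter hx' hY g
  have hz' : IsZero ((uIso W).Q.obj z) := isZero_of_supportedOn (by
    rw [hW, Opens.coe_sup, Set.compl_union]; exact hz)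
  rw [← cancel_epi (onOpen W s), hsg, comp_zero, onOpen_comp, hz'.eq_of_tgt (onOpen W u) 0,
    zero_comp]

/-- Tensoring on the right with an object of `K`, as a functor on `L(U)`. -/
noncomputable def tensorL (U : Opens (Spc K)) (c : K) : LU U ⥤ LU U :=
  Localization.Construction.lift (tensorRight c ⋙ (uIso U).Q) (by
    rintro x y f ⟨z, g, k, hT, hz⟩
    let _ := TensorTriangulated.commShiftRight c
    have := TensorTriangulated.exactRight c
    exact (uIso U).Q_inverts _ ⟨_, _, _, (tensorRight c).map_distinguished _ hT,
      (isThickIdeal_supportedOn _).ideal z c hz⟩)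

instance tensorL_additive (c : K) : (tensorL U c).Additive := by
  rw [Localization.functor_additive_iff (uIso U).Q (uIso U)]
  let _ := TensorTriangulated.commShiftRight c
  have := TensorTriangulated.exactRight c
  have h : (uIso U).Q ⋙ tensorL U c = tensorRight c ⋙ (uIso U).Q :=
    Localization.Construction.fac _ _
  rw [h]
  infer_instance

lemma FactorsThrough.tensorL_map (h : V ≤ U) (c : K) {X Y : LU U} {f : X ⟶ Y}
    (hf : FactorsThrough (ker h) f) : FactorsThrough (ker h) ((tensorL U c).map f) := by
  obtain ⟨Z, hZ, u, w, rfl⟩ := hf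
  obtain ⟨z, rfl⟩ := exists_eq_Q_obj Z
  refine ⟨(tensorL U c).obj ((uIso U).Q.obj z), ?_, (tensorL U c).map u, (tensorL U c).map w,
    ((tensorL U c).map_comp u w).symm⟩
  rw [ker_Q_obj_iff] at hZ
  exact (ker_Q_obj_iff h (x := z ⊗ c)).2 ((isThickIdeal_supportedOn _).ideal z c hZ)

/-- For the ideal property: tensoring with `c` descends to `L(W)` and preserves both kernels, hence
carries a decomposition of `𝟙 a` to one of `𝟙 (a ⊗ c)`. -/
lemma isThickIdeal_dec (hU : U ≤ W) (hV : V ≤ W) (hW : W = U ⊔ V) :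
    IsThickIdeal ((dec (ker hU) (ker hV)).inverseImage (uIso W).Q) := by
  have hUV := homZero_ker hU hV hW
  have hVU := homZero_ker hV hU (hW.trans (sup_comm _ _))
  have := dec_isTriangulated hUV hVU
  have : (dec (ker hU) (ker hV)).IsStableUnderRetracts := by
    rw [dec_eq_retractClosure hVU]
    infer_instance
  refine ⟨inferInstance, ⟨fun r hb =>
    (dec (ker hU) (ker hV)).prop_of_retract (r.map (uIso W).Q) hb⟩, ?_⟩
  rintro a c ⟨f₁, f₂, h₁, h₂, h⟩
  refine ⟨(tensorL W c).map f₁, (tensorL W c).map f₂, h₁.tensorL_map hU c, h₂.tensorL_map hV c,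
    ?_⟩
  have := congrArg (tensorL W c).map h
  rw [Functor.map_add] at this
  exact ((tensorL W c).map_id _).symm.trans this

/-- The ideal of decomposable objects contains `b` and `c`, whose supports are the complements of
`U` and `V`; hence it contains everything supported on `supp (b ⊞ c)`. -/
lemma dec_Q_obj (hU : U ≤ W) (hV : V ≤ W) (hW : W = U ⊔ V) (hUc : IsCompact (U : Set (Spc K)))
    (hVc : IsCompact (V : Set (Spc K))) {z : K}
    (hz : supportedOn ((U ⊓ V : Opens (Spc K)) : Set (Spc K))ᶜ z) :
    dec (ker hU) (ker hV) ((uIso W).Q.obj z) := by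
  obtain ⟨b, hb⟩ := exists_compl_eq_supp hUc
  obtain ⟨c, hc⟩ := exists_compl_eq_supp hVc
  have hI := isThickIdeal_dec hU hV hW
  have := hI.triangulated
  have := hI.isClosedUnderIsomorphisms
  refine hI.prop_of_supp_subset (b := b ⊞ c) ?_ ?_
  · refine ObjectProperty.ext_of_isTriangulatedClosed₂ _ _
      (binaryBiproductTriangle_distinguished b c) ?_ ?_
    · exact (⟨𝟙 _, 0, ⟨_, (ker_Q_obj_iff hU).2 hb.ge, 𝟙 _, 𝟙 _, by simp⟩,
        ⟨_, (ker hV).prop_zero, 0, 0, by simp⟩, by simp⟩ :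
        dec (ker hU) (ker hV) ((uIso W).Q.obj b))
    · exact (⟨0, 𝟙 _, ⟨_, (ker hU).prop_zero, 0, 0, by simp⟩,
        ⟨_, (ker_Q_obj_iff hV).2 hc.ge, 𝟙 _, 𝟙 _, by simp⟩, by simp⟩ :
        dec (ker hU) (ker hV) ((uIso W).Q.obj c))
  · rw [supp_biprod, ← hb, ← hc, ← Set.compl_inter]
    exact hz

lemma decomposes_of_resHom_eq_zero (hU : U ≤ W) (hV : V ≤ W) (hW : W = U ⊔ V)
    (hUc : IsCompact (U : Set (Spc K))) (hVc : IsCompact (V : Set (Spc K)))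
    {f : HomOn W x y} (hf : resHom (inf_le_left.trans hU : U ⊓ V ≤ W) f = 0) :
    Decomposes (ker hU) (ker hV) f := by
  obtain ⟨Z, hZ, u, w, rfl⟩ := factorsThrough_of_resHom_eq_zero _ hf
  obtain ⟨z, rfl⟩ := exists_eq_Q_obj Z
  exact Decomposes.of_dec (dec_Q_obj hU hV hW hUc hVc ((ker_Q_obj_iff _).1 hZ)) u w

end Kernels

end Localization

/-! ### Triangles and retracts under an exact functor -/

section RetractMap

variable {T T' : Type*} [Category* T] [Preadditive T] [HasZeroObject T] [HasShift T ℤ]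
  [∀ n : ℤ, (shiftFunctor T n).Additive] [Pretriangulated T]
  [Category* T'] [Preadditive T'] [HasZeroObject T'] [HasShift T' ℤ]
  [∀ n : ℤ, (shiftFunctor T' n).Additive] [Pretriangulated T']

lemma exists_retract_map (F : T ⥤ T') [F.CommShift ℤ] [F.IsTriangulated] {w c m x z : T}
    {j : w ⟶ c} {l : c ⟶ m} {k : m ⟶ w⟦(1 : ℤ)⟧} {r : w ⟶ x} {l' : x ⟶ z} {k' : z ⟶ w⟦(1 : ℤ)⟧}
    (hT : Triangle.mk j l k ∈ distTriang T) (hT' : Triangle.mk r l' k' ∈ distTriang T)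
    (φ : m ⟶ z) (ψ : z ⟶ m) (hφ : F.map (φ ≫ k') = F.map k) (hψ : F.map (ψ ≫ k) = F.map k')
    (h : F.map (ψ ≫ φ) = 𝟙 _) :
    ∃ (f : F.obj c ⟶ F.obj x) (f' : F.obj x ⟶ F.obj c), f' ≫ f = 𝟙 _ ∧ F.map j ≫ f = F.map r :=
  exists_retract_of_triangles (k := F.map k ≫ (F.commShiftIso (1 : ℤ)).hom.app w)
    (k' := F.map k' ≫ (F.commShiftIso (1 : ℤ)).hom.app w)
    (F.map_distinguished _ hT) (F.map_distinguished _ hT') (F.map φ) (F.map ψ)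
    (by rw [← Category.assoc, ← Functor.map_comp, hφ])
    (by rw [← Category.assoc, ← Functor.map_comp, hψ])
    (by rw [← Functor.map_comp, h])

lemma exists_triangle_map (F : T ⥤ T') [F.CommShift ℤ] [F.IsTriangulated] {a b c : T}
    {f : a ⟶ b} {g : b ⟶ c} {h : c ⟶ a⟦(1 : ℤ)⟧} (hT : Triangle.mk f g h ∈ distTriang T) :
    ∃ k, Triangle.mk (F.map f) (F.map g) k ∈ distTriang T' :=
  ⟨_, F.map_distinguished _ hT⟩

lemma distTriang_isIso₁ {a b c : T} {f : a ⟶ b} {g : b ⟶ c} {h : c ⟶ a⟦(1 : ℤ)⟧}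
    (hT : Triangle.mk f g h ∈ distTriang T) : IsIso f ↔ IsZero c :=
  (Triangle.isZero₃_iff_isIso₁ _ hT).symm

end RetractMap

/-! ### Translation of morphisms on an open subset -/

section Twist

variable {K : Type u} [Category.{v} K] [Preadditive K] [HasZeroObject K] [HasShift K ℤ]
  [∀ n : ℤ, (shiftFunctor K n).Additive] [Pretriangulated K] [IsTriangulated K]
  [MonoidalCategory K] {U V : Opens (Spc K)} {x y z : K}

/-- The translation of a morphism on `U`. -/
noncomputable def twist (f : HomOn U x y) : HomOn U (x⟦(1 : ℤ)⟧) (y⟦(1 : ℤ)⟧) :=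
  ((uIso U).Q.commShiftIso (1 : ℤ)).hom.app x ≫ f⟦(1 : ℤ)⟧' ≫
    ((uIso U).Q.commShiftIso (1 : ℤ)).inv.app y

lemma twist_comp (f : HomOn U x y) (g : HomOn U y z) : twist (f ≫ g) = twist f ≫ twist g := by
  simp [twist]

lemma twist_onOpen (f : x ⟶ y) : twist (onOpen U f) = onOpen U (f⟦(1 : ℤ)⟧') := by
  have := ((uIso U).Q.commShiftIso (1 : ℤ)).hom.naturality f
  dsimp at this
  rw [twist, ← Category.assoc]
  exact (congrArg (· ≫ ((uIso U).Q.commShiftIso (1 : ℤ)).inv.app y) this.symm).trans (by simp)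

/-- Both sides respect composition and agree on images from `K`, so a roof decides. -/
lemma resHom_twist (h : V ≤ U) (f : HomOn U x y) :
    resHom h (twist f) = twist (resHom h f) := by
  obtain ⟨x', s, g, hs, hsg⟩ := exists_roof f
  have hs' : uIso U (s⟦(1 : ℤ)⟧') := ObjectProperty.trW.shift hs 1
  have := isIso_onOpen (uIso_anti h _ hs')
  have h₁ : onOpen V (s⟦(1 : ℤ)⟧') ≫ resHom h (twist f) = onOpen V (g⟦(1 : ℤ)⟧') := by
    rw [← resHom_onOpen h, ← resHom_onOpen h, ← resHom_comp, ← twist_onOpen, ← twist_comp, hsg,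
      twist_onOpen]
  have h₂ : onOpen V (s⟦(1 : ℤ)⟧') ≫ twist (resHom h f) = onOpen V (g⟦(1 : ℤ)⟧') := by
    rw [← twist_onOpen, ← twist_onOpen, ← twist_comp, ← resHom_onOpen h, ← resHom_comp, hsg,
      resHom_onOpen]
  rw [← cancel_epi (onOpen V (s⟦(1 : ℤ)⟧')), h₁, h₂]

end Twist

/-! ### Mayer-Vietoris for two open subsets -/

section Binary

variable {K : Type u} [Category.{v} K] [Preadditive K] [HasZeroObject K] [HasShift K ℤ]
  [∀ n : ℤ, (shiftFunctor K n).Additive] [Pretriangulated K] [IsTriangulated K]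
  [MonoidalCategory K] [SymmetricCategory K] [TensorTriangulated K] [MonoidalClosed K]
  [StronglyClosed K] {U V W : Opens (Spc K)} {x y : K}

lemma resHom_inv {h : V ≤ U} (e : HomOn U x y) [IsIso e] : IsIso (resHom h e) :=
  inferInstanceAs (IsIso ((resL h).map e))

lemma isIso_resHom_of_trW {U' : Opens (Spc K)} (h : U ≤ W) (h' : U' ≤ U) {e : HomOn W x y}
    (he : (ker h).trW e) : IsIso (resHom (h'.trans h) e) := by
  have h₁ : IsIso (resHom h e) := (trW_ker_iff h e).1 he
  rw [← resHom_resHom h h']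
  exact resHom_inv _

lemma exists_hom_of_eq_on_inf (hU : U ≤ W) (hV : V ≤ W) (hW : W = U ⊔ V)
    (hUc : IsCompact (U : Set (Spc K))) (hVc : IsCompact (V : Set (Spc K)))
    (f₁ : HomOn U x y) (f₂ : HomOn V x y)
    (hf : resHom (inf_le_left : U ⊓ V ≤ U) f₁ = resHom (inf_le_right : U ⊓ V ≤ V) f₂) :
    ∃ f : HomOn W x y, resHom hU f = f₁ ∧ resHom hV f = f₂ := by
  obtain ⟨a₁, s, g₁, hs, h₁⟩ := exists_roof f₁
  obtain ⟨a₂, t, g₂, ht, h₂⟩ := exists_roof f₂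
  have := isIso_onOpen hs
  have := isIso_onOpen ht
  have hs' : (ker hU).trW (onOpen W s) := (trW_ker_iff hU _).2 (by
    change IsIso (resHom hU (onOpen W s)); rwa [resHom_onOpen])
  have ht' : (ker hV).trW (onOpen W t) := (trW_ker_iff hV _).2 (by
    change IsIso (resHom hV (onOpen W t)); rwa [resHom_onOpen])
  obtain ⟨h, hh₁, hh₂⟩ := exists_glued_hom (homZero_ker hU hV hW)
    (homZero_ker hV hU (hW.trans (sup_comm _ _))) hs' ht' (onOpen W g₁) (onOpen W g₂) (by
      intro A₃ t' s' _ _ hst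
      obtain ⟨a₃, rfl⟩ := exists_eq_Q_obj A₃
      refine decomposes_of_resHom_eq_zero hU hV hW hUc hVc ?_
      have e₁ := congrArg (resHom (inf_le_left : U ⊓ V ≤ U)) h₁
      have e₂ := congrArg (resHom (inf_le_right : U ⊓ V ≤ V)) h₂
      have e₃ := congrArg (resHom (inf_le_left.trans hU : U ⊓ V ≤ W)) hst
      simp only [resHom_comp, resHom_onOpen] at e₁ e₂ e₃
      simp only [resHom_comp, resHom_onOpen, resHom_sub]
      rw [← e₁, ← e₂, ← Category.assoc, e₃, hf, Category.assoc, sub_self])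
  refine ⟨h, ?_, ?_⟩
  · have := resHom_eq_zero_of_factorsThrough hU hh₁
    rw [resHom_sub, resHom_comp, resHom_onOpen, resHom_onOpen, ← h₁, sub_eq_zero] at this
    exact (cancel_epi _).1 this
  · have := resHom_eq_zero_of_factorsThrough hV hh₂
    rw [resHom_sub, resHom_comp, resHom_onOpen, resHom_onOpen, ← h₂, sub_eq_zero] at this
    exact (cancel_epi _).1 this

lemma eq_zero_of_resHom_eq_zero (hU : U ≤ W) (hV : V ≤ W) (hW : W = U ⊔ V)
    (hUc : IsCompact (U : Set (Spc K))) (hVc : IsCompact (V : Set (Spc K)))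
    {f : HomOn W x y} {p : HomOn W x x} {q : HomOn W y y} (hp : p ≫ f = f) (hq : f ≫ q = f)
    (h₁ : resHom hU f = 0) (h₂ : resHom hV f = 0)
    (hd : ∀ h : HomOn (U ⊓ V) (x⟦(1 : ℤ)⟧) y, twist (resHom (inf_le_left.trans hU) p) ≫ h ≫
      resHom (inf_le_left.trans hU) q = 0) : f = 0 := by
  refine eq_zero_of_factorsThrough (homZero_ker hU hV hW)
    (homZero_ker hV hU (hW.trans (sup_comm _ _))) hp hq (factorsThrough_of_resHom_eq_zero _ h₁)
    (factorsThrough_of_resHom_eq_zero _ h₂) ?_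
  intro A₁ A₁' A₃ A₃' e₁ e₂ e₁' e₂' ρ g he₁ he₂ _ _ hρ
  obtain ⟨a₁, rfl⟩ := exists_eq_Q_obj A₁
  obtain ⟨a₁', rfl⟩ := exists_eq_Q_obj A₁'
  obtain ⟨a₃, rfl⟩ := exists_eq_Q_obj A₃
  obtain ⟨a₃', rfl⟩ := exists_eq_Q_obj A₃'
  have hD : U ⊓ V ≤ W := inf_le_left.trans hU
  have i₁ : IsIso (resHom hD e₁) := isIso_resHom_of_trW hV inf_le_right he₁
  have i₂ : IsIso (resHom hD e₂) := isIso_resHom_of_trW hU inf_le_left he₂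
  let g' : HomOn W (a₃⟦(1 : ℤ)⟧) y := ((uIso W).Q.commShiftIso (1 : ℤ)).hom.app a₃ ≫ g
  have key : resHom hD (twist ρ ≫ g' ≫ q) = 0 := by
    have h := congrArg (resHom hD) hρ
    simp only [resHom_comp] at h
    -- On `U ⊓ V` the maps `e₁` and `e₂` are invertible, so `ρ` factors through `p` and `hd`
    -- applies.
    have h' : resHom hD ρ = ((resHom hD e₁' ≫ resHom hD e₂') ≫ resHom hD p) ≫
        inv (resHom hD e₁ ≫ resHom hD e₂) := by
      rw [← h, Category.assoc, IsIso.hom_inv_id, Category.comp_id]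
    rw [resHom_comp, resHom_twist, h', twist_comp, twist_comp, resHom_comp]
    have := hd (twist (inv (resHom hD e₁ ≫ resHom hD e₂)) ≫ resHom hD g')
    simp only [Category.assoc] at this ⊢
    rw [this, comp_zero]
  have h := decomposes_of_resHom_eq_zero hU hV hW hUc hVc key
  have := h.precomp (((uIso W).Q.commShiftIso (1 : ℤ)).inv.app a₃')
  have e : ρ⟦(1 : ℤ)⟧' ≫ g ≫ q =
      ((uIso W).Q.commShiftIso (1 : ℤ)).inv.app a₃' ≫ twist ρ ≫ g' ≫ q := by
    simp only [twist, g', Category.assoc]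
    erw [Iso.inv_hom_id_app_assoc, Iso.inv_hom_id_app_assoc]
  rw [e]
  exact this

/-- Write `σ` as a roof `x ← w → y`, with cones `z₁`, `z₂` supported off `U ∩ V`. An object `c`
between the legs should have over `w` the cone `z₁` on `U` and `z₂` on `V`. Decomposability gives
these cones only as retracts, so `x` and `y` are only retracts of `c`. -/
lemma exists_weak_gluing (hU : U ≤ W) (hV : V ≤ W) (hW : W = U ⊔ V)
    (hUc : IsCompact (U : Set (Spc K))) (hVc : IsCompact (V : Set (Spc K)))
    (σ : HomOn (U ⊓ V) x y) [IsIso σ] :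
    ∃ (c : K) (α : HomOn U c x) (α' : HomOn U x c) (β : HomOn V c y) (β' : HomOn V y c),
      α' ≫ α = 𝟙 _ ∧ β' ≫ β = 𝟙 _ ∧ IsIso (resHom (inf_le_left : U ⊓ V ≤ U) α) ∧
        resHom inf_le_left α ≫ σ = resHom inf_le_right β := by
  obtain ⟨w, s, g, hs, hsg⟩ := exists_roof σ
  have hs' := isIso_onOpen hs
  have hg' : IsIso (onOpen (U ⊓ V) g) := by rw [← hsg]; infer_instance
  obtain ⟨z₁, l₁, k₁, hT₁, hz₁⟩ := hs
  obtain ⟨z₂, l₂, k₂, hT₂⟩ := distinguished_cocone_triangle g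
  have hz₂ : supportedOn ((U ⊓ V : Opens (Spc K)) : Set (Spc K))ᶜ z₂ := by
    obtain ⟨k, hk⟩ := exists_triangle_map (uIso (U ⊓ V)).Q hT₂
    exact supportedOn_of_isZero ((distTriang_isIso₁ hk).1 hg')
  obtain ⟨k₁', hT₁'⟩ := exists_triangle_map (uIso W).Q hT₁
  obtain ⟨k₂', hT₂'⟩ := exists_triangle_map (uIso W).Q hT₂
  obtain ⟨f₁, f₁', hf₁, ⟨Y₁, hY₁, u₁, v₁, rfl⟩, h₁⟩ := dec_Q_obj hU hV hW hUc hVc hz₁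
  obtain ⟨f₂, f₂', ⟨X₂, hX₂, u₂, v₂, rfl⟩, hf₂', h₂⟩ := dec_Q_obj hU hV hW hUc hVc hz₂
  -- `X₂` vanishes on `U`, where `Y₁` has `z₁` as a retract; `Y₁` vanishes on `V`, where `X₂` has
  -- `z₂` as a retract.
  obtain ⟨C, j, l, hC⟩ :=
    distinguished_cocone_triangle₂ (biprod.desc (v₂ ≫ k₂') (v₁ ≫ k₁') : X₂ ⊞ Y₁ ⟶ _)
  obtain ⟨c, rfl⟩ := exists_eq_Q_obj C
  have hf₁0 : (resL hU).map f₁ = 0 := resHom_eq_zero_of_factorsThrough hU hf₁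
  have hf₂0 : (resL hV).map f₂' = 0 := resHom_eq_zero_of_factorsThrough hV hf₂'
  obtain ⟨α, α', hα, hjα⟩ : ∃ (α : HomOn U c x) (α' : HomOn U x c), α' ≫ α = 𝟙 _ ∧
      resHom hU (x := w) (y := c) j ≫ α = resHom hU (onOpen W s) := exists_retract_map (resL hU) hC hT₁' (biprod.snd ≫ v₁)
    (u₁ ≫ biprod.inr) (by
      rw [biprod.desc_eq, Functor.map_add, (resL hU).map_comp biprod.fst,
        IsZero.eq_of_tgt hX₂ ((resL hU).map biprod.fst) 0, zero_comp, zero_add, Category.assoc])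
    (by
      rw [Category.assoc, biprod.inr_desc, ← Category.assoc, eq_sub_of_add_eq' h₁.symm,
        Preadditive.sub_comp, Functor.map_sub, Category.id_comp, Functor.map_comp _ f₁, hf₁0,
        zero_comp, sub_zero])
    (by
      rw [Category.assoc, biprod.inr_snd_assoc, eq_sub_of_add_eq' h₁.symm, Functor.map_sub, hf₁0,
        sub_zero, CategoryTheory.Functor.map_id])
  obtain ⟨β, β', hβ, hjβ⟩ : ∃ (β : HomOn V c y) (β' : HomOn V y c), β' ≫ β = 𝟙 _ ∧
      resHom hV (x := w) (y := c) j ≫ β = resHom hV (onOpen W g) := exists_retract_map (resL hV) hC hT₂' (biprod.fst ≫ v₂)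
    (u₂ ≫ biprod.inl) (by
      rw [biprod.desc_eq, Functor.map_add, (resL hV).map_comp biprod.snd,
        IsZero.eq_of_tgt hY₁ ((resL hV).map biprod.snd) 0, zero_comp, add_zero, Category.assoc])
    (by
      rw [Category.assoc, biprod.inl_desc, ← Category.assoc, eq_sub_of_add_eq h₂.symm,
        Preadditive.sub_comp, Functor.map_sub, Category.id_comp, Functor.map_comp _ f₂', hf₂0,
        zero_comp, sub_zero])
    (by
      rw [Category.assoc, biprod.inl_fst_assoc, eq_sub_of_add_eq h₂.symm, Functor.map_sub, hf₂0,
        sub_zero, CategoryTheory.Functor.map_id])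
  have hj : IsIso (resHom (inf_le_left.trans hU : U ⊓ V ≤ W) j) := by
    obtain ⟨k, hk⟩ := exists_triangle_map (resL (inf_le_left.trans hU : U ⊓ V ≤ W)) hC
    refine (distTriang_isIso₁ hk).2 ?_
    have hX₂' : IsZero ((resL (inf_le_left.trans hU : U ⊓ V ≤ W)).obj X₂) := by
      rw [resL_comp hU inf_le_left]
      exact (resL inf_le_left).map_isZero hX₂
    have hY₁' : IsZero ((resL (inf_le_right.trans hV : U ⊓ V ≤ W)).obj Y₁) := by
      rw [resL_comp hV inf_le_right]
      exact (resL inf_le_right).map_isZero hY₁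
    exact ObjectProperty.ext_of_isTriangulatedClosed₂ (ker (inf_le_left.trans hU : U ⊓ V ≤ W)) _
      (binaryBiproductTriangle_distinguished X₂ Y₁) hX₂' hY₁'
  have eα : resHom (inf_le_left.trans hU : U ⊓ V ≤ W) j ≫ resHom inf_le_left (U := U) (x := c) α =
      onOpen (U ⊓ V) s := by
    have := congrArg (resHom (inf_le_left : U ⊓ V ≤ U)) hjα
    simpa only [resHom_comp, resHom_resHom, resHom_onOpen] using this
  have eβ : resHom (inf_le_left.trans hU : U ⊓ V ≤ W) j ≫ resHom inf_le_right (U := V) (x := c) β =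
      onOpen (U ⊓ V) g := by
    have := congrArg (resHom (inf_le_right : U ⊓ V ≤ V)) hjβ
    simpa only [resHom_comp, resHom_resHom, resHom_onOpen] using this
  refine ⟨c, α, α', β, β', hα, hβ, ?_, ?_⟩
  · have : IsIso (resHom (inf_le_left.trans hU : U ⊓ V ≤ W) j ≫
        resHom inf_le_left (U := U) (x := c) α) := by rw [eα]; exact hs'
    exact IsIso.of_isIso_comp_left (resHom (inf_le_left.trans hU : U ⊓ V ≤ W) j) _
  · rw [← cancel_epi (resHom (inf_le_left.trans hU : U ⊓ V ≤ W) j), ← Category.assoc, eα, hsg, eβ]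

end Binary

/-! ### Isomorphisms between summands cut out by idempotents -/

section Category

variable {C D : Type*} [Category* C] [Category* D] {x y z : C}

/-- The morphisms `f` and `f'` are inverse isomorphisms between the direct summands cut out by
the idempotents `p` and `q`. -/
structure IdemIso (p : x ⟶ x) (q : y ⟶ y) (f : x ⟶ y) (f' : y ⟶ x) : Prop where
  hom_inv : f ≫ f' = p
  inv_hom : f' ≫ f = q
  hom_comp : f ≫ q = f
  comp_inv : q ≫ f' = f'

namespace IdemIso

variable {p : x ⟶ x} {q : y ⟶ y} {r : z ⟶ z} {f : x ⟶ y} {f' f'' : y ⟶ x} {g : y ⟶ z}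
  {g' : z ⟶ y}

lemma comp_hom (h : IdemIso p q f f') : p ≫ f = f := by
  rw [← h.hom_inv, Category.assoc, h.inv_hom, h.hom_comp]

lemma inv_comp (h : IdemIso p q f f') : f' ≫ p = f' := by
  rw [← h.hom_inv, ← Category.assoc, h.inv_hom, h.comp_inv]

lemma symm (h : IdemIso p q f f') : IdemIso q p f' f :=
  ⟨h.inv_hom, h.hom_inv, h.inv_comp, h.comp_hom⟩

lemma idem_right (h : IdemIso p q f f') : q ≫ q = q := by
  nth_rw 1 [← h.inv_hom]
  rw [Category.assoc, h.hom_comp, h.inv_hom]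

lemma idem_left (h : IdemIso p q f f') : p ≫ p = p := h.symm.idem_right

lemma trans (h : IdemIso p q f f') (h' : IdemIso q r g g') :
    IdemIso p r (f ≫ g) (g' ≫ f') where
  hom_inv := by
    rw [Category.assoc, ← Category.assoc g, h'.hom_inv, h.comp_inv, h.hom_inv]
  inv_hom := by
    rw [Category.assoc, ← Category.assoc f', h.inv_hom, h'.comp_hom, h'.inv_hom]
  hom_comp := by rw [Category.assoc, h'.hom_comp]
  comp_inv := by rw [← Category.assoc, h'.comp_inv]

lemma inv_unique (h : IdemIso p q f f') (h' : IdemIso p q f f'') : f' = f'' := by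
  rw [← h.comp_inv, ← h'.inv_hom, Category.assoc, h.hom_inv, h'.inv_comp]

lemma refl (hp : p ≫ p = p) : IdemIso p p p p := ⟨hp, hp, hp, hp⟩

end IdemIso

end Category

/-! ### Lifting idempotents and exchanging isomorphic summands -/

section Preadditive

variable {C : Type*} [Category* C] [Preadditive C] {x y b : C}

/-- The classical lift `3a² - 2a³`, with the coefficients written as repeated sums. -/
lemma exists_idempotent_of_sq_eq_zero (a : x ⟶ x)
    (h : (a ≫ a - a) ≫ (a ≫ a - a) = 0) :
    (a ≫ a + a ≫ a + a ≫ a - a ≫ a ≫ a - a ≫ a ≫ a) ≫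
      (a ≫ a + a ≫ a + a ≫ a - a ≫ a ≫ a - a ≫ a ≫ a) =
    a ≫ a + a ≫ a + a ≫ a - a ≫ a ≫ a - a ≫ a ≫ a := by
  have key : ∀ A : End x, (A * A - A) * (A * A - A) = 0 →
      (A * A + A * A + A * A - A * A * A - A * A * A) *
        (A * A + A * A + A * A - A * A * A - A * A * A) =
      A * A + A * A + A * A - A * A * A - A * A * A := by
    intro A hA
    have : (A * A + A * A + A * A - A * A * A - A * A * A) *
        (A * A + A * A + A * A - A * A * A - A * A * A) -
      (A * A + A * A + A * A - A * A * A - A * A * A) =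
      ((A * A - A) * (A * A - A)) * (4 * (A * A) - 4 * A - 3) := by noncomm_ring
    rw [hA, zero_mul, sub_eq_zero] at this
    exact this
  exact key a h

variable {fst : b ⟶ x} {snd : b ⟶ y} {inl : x ⟶ b} {inr : y ⟶ b} {p : x ⟶ x} {q : y ⟶ y}
  {σ : x ⟶ y} {τ : y ⟶ x}

/-- The automorphism of `x ⊞ y` which exchanges the summands `p` and `q` and is the identity on
their complements. -/
def exchange (fst : b ⟶ x) (snd : b ⟶ y) (inl : x ⟶ b) (inr : y ⟶ b) (p : x ⟶ x) (q : y ⟶ y)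
    (σ : x ⟶ y) (τ : y ⟶ x) : b ⟶ b :=
  fst ≫ (inl - p ≫ inl + σ ≫ inr) + snd ≫ (inr - q ≫ inr + τ ≫ inl)

lemma inl_exchange (h₁ : inl ≫ fst = 𝟙 x) (h₂ : inl ≫ snd = 0) :
    inl ≫ exchange fst snd inl inr p q σ τ = inl - p ≫ inl + σ ≫ inr := by
  rw [exchange, Preadditive.comp_add, ← Category.assoc, h₁, Category.id_comp, ← Category.assoc,
    h₂, zero_comp, add_zero]

lemma inr_exchange (h₁ : inr ≫ snd = 𝟙 y) (h₂ : inr ≫ fst = 0) :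
    inr ≫ exchange fst snd inl inr p q σ τ = inr - q ≫ inr + τ ≫ inl := by
  rw [exchange, Preadditive.comp_add, ← Category.assoc, h₂, zero_comp, ← Category.assoc,
    h₁, Category.id_comp, zero_add]

lemma exchange_exchange (h₁ : inl ≫ fst = 𝟙 x) (h₂ : inl ≫ snd = 0) (h₃ : inr ≫ snd = 𝟙 y)
    (h₄ : inr ≫ fst = 0) (h₅ : fst ≫ inl + snd ≫ inr = 𝟙 b) (h : IdemIso p q σ τ) :
    exchange fst snd inl inr p q σ τ ≫ exchange fst snd inl inr p q σ τ = 𝟙 b := by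
  nth_rw 1 [exchange]
  simp only [Preadditive.add_comp, Preadditive.sub_comp, Category.assoc, inl_exchange h₁ h₂,
    inr_exchange h₃ h₄, Preadditive.comp_add, Preadditive.comp_sub]
  simp only [← Category.assoc, h.hom_inv, h.inv_hom]
  simp only [Category.assoc]
  simp only [← Category.assoc _ _ inl, ← Category.assoc _ _ inr, h.idem_left, h.idem_right,
    h.hom_comp, h.comp_hom, h.comp_inv, h.inv_comp]
  rw [← h₅]
  abel

lemma exchange_snd (h₂ : inl ≫ snd = 0) (h₃ : inr ≫ snd = 𝟙 y) (h : IdemIso p q σ τ) :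
    exchange fst snd inl inr p q σ τ ≫ snd ≫ q = fst ≫ σ := by
  simp only [exchange, Preadditive.add_comp, Preadditive.sub_comp, Category.assoc,
    ← Category.assoc inl, ← Category.assoc inr, h₂, h₃, zero_comp, comp_zero, Category.id_comp,
    h.idem_right, h.hom_comp]
  simp

lemma comp_inr_exchange (h₃ : inr ≫ snd = 𝟙 y) (h₄ : inr ≫ fst = 0) (h : IdemIso p q σ τ) :
    q ≫ inr ≫ exchange fst snd inl inr p q σ τ = τ ≫ inl := by
  rw [inr_exchange h₃ h₄, Preadditive.comp_add, Preadditive.comp_sub, ← Category.assoc q q,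
    h.idem_right, sub_self, zero_add, ← Category.assoc, h.comp_inv]

end Preadditive

/-! ### Gluing two direct summands -/

section Gluing

variable {K : Type u} [Category.{v} K] [Preadditive K] [HasZeroObject K] [HasShift K ℤ]
  [∀ n : ℤ, (shiftFunctor K n).Additive] [Pretriangulated K] [IsTriangulated K]
  [MonoidalCategory K] {U V W : Opens (Spc K)} {x y : K}

lemma IdemIso.resHom {p : HomOn U x x} {q : HomOn U y y} {f : HomOn U x y} {f' : HomOn U y x}
    (h : IdemIso p q f f') (hV : V ≤ U) :
    IdemIso (resHom hV p) (resHom hV q) (resHom hV f) (resHom hV f') where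
  hom_inv := by rw [← resHom_comp, h.hom_inv]
  inv_hom := by rw [← resHom_comp, h.inv_hom]
  hom_comp := by rw [← resHom_comp, h.hom_comp]
  comp_inv := by rw [← resHom_comp, h.comp_inv]

variable [SymmetricCategory K] [TensorTriangulated K] [MonoidalClosed K] [StronglyClosed K]

/-- For any gluing `a` of `e₁` and `e₂`, the defect `a² - a` factors through both kernels, so its
square vanishes by orthogonality. The lift `3a² - 2a³` has the same restrictions as `a`. -/
lemma exists_idempotent_of_eq_on_inf (hU : U ≤ W) (hV : V ≤ W) (hW : W = U ⊔ V)
    (hUc : IsCompact (U : Set (Spc K))) (hVc : IsCompact (V : Set (Spc K)))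
    (e₁ : HomOn U x x) (e₂ : HomOn V x x) (h₁ : e₁ ≫ e₁ = e₁) (h₂ : e₂ ≫ e₂ = e₂)
    (he : resHom (inf_le_left : U ⊓ V ≤ U) e₁ = resHom (inf_le_right : U ⊓ V ≤ V) e₂) :
    ∃ e : HomOn W x x, e ≫ e = e ∧ resHom hU e = e₁ ∧ resHom hV e = e₂ := by
  obtain ⟨a, ha₁, ha₂⟩ := exists_hom_of_eq_on_inf hU hV hW hUc hVc e₁ e₂ he
  refine ⟨_, exists_idempotent_of_sq_eq_zero a (FactorsThrough.comp_eq_zero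
    (homZero_ker hU hV hW) (factorsThrough_of_resHom_eq_zero hU ?_)
      (factorsThrough_of_resHom_eq_zero hV ?_)), ?_, ?_⟩
  · rw [resHom_sub, resHom_comp, ha₁, h₁, sub_self]
  · rw [resHom_sub, resHom_comp, ha₂, h₂, sub_self]
  · simp only [resHom_sub, resHom_add, resHom_comp, ha₁, h₁]
    abel
  · simp only [resHom_sub, resHom_add, resHom_comp, ha₂, h₂]
    abel

/-- An isomorphism of summands need not extend to one of `x` with `y`, but it extends to the
involution `exchange` of `x ⊞ y`. Weak gluing along this involution gives `c`; the idempotents of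
`c` induced by `p` on `U` and by `q` on `V` agree on the overlap and glue. -/
lemma exists_gluing_pair (hU : U ≤ W) (hV : V ≤ W) (hW : W = U ⊔ V)
    (hUc : IsCompact (U : Set (Spc K))) (hVc : IsCompact (V : Set (Spc K)))
    {p : HomOn U x x} {q : HomOn V y y} (hp : p ≫ p = p) (hq : q ≫ q = q)
    {σ : HomOn (U ⊓ V) x y} {τ : HomOn (U ⊓ V) y x}
    (h : IdemIso (resHom inf_le_left p) (resHom inf_le_right q) σ τ) :
    ∃ (c : K) (e : HomOn W c c) (f : HomOn U c x) (f' : HomOn U x c) (g : HomOn V c y)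
      (g' : HomOn V y c), IdemIso (resHom hU e) p f f' ∧ IdemIso (resHom hV e) q g g' ∧
        e ≫ e = e ∧ resHom inf_le_left f ≫ σ = resHom inf_le_right g := by
  have h₁ (W : Opens (Spc K)) : onOpen W (biprod.inl : x ⟶ x ⊞ y) ≫ onOpen W biprod.fst = 𝟙 _ := by
    rw [← onOpen_comp, biprod.inl_fst]; exact (uIso W).Q.map_id _
  have h₂ (W : Opens (Spc K)) : onOpen W (biprod.inl : x ⟶ x ⊞ y) ≫ onOpen W biprod.snd = 0 := by
    rw [← onOpen_comp, biprod.inl_snd]; exact (uIso W).Q.map_zero _ _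
  have h₃ (W : Opens (Spc K)) : onOpen W (biprod.inr : y ⟶ x ⊞ y) ≫ onOpen W biprod.snd = 𝟙 _ := by
    rw [← onOpen_comp, biprod.inr_snd]; exact (uIso W).Q.map_id _
  have h₄ (W : Opens (Spc K)) : onOpen W (biprod.inr : y ⟶ x ⊞ y) ≫ onOpen W biprod.fst = 0 := by
    rw [← onOpen_comp, biprod.inr_fst]; exact (uIso W).Q.map_zero _ _
  have h₅ (W : Opens (Spc K)) : onOpen W (biprod.fst : x ⊞ y ⟶ x) ≫ onOpen W biprod.inl +
      onOpen W (biprod.snd : x ⊞ y ⟶ y) ≫ onOpen W biprod.inr = 𝟙 _ := by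
    rw [← onOpen_comp, ← onOpen_comp, ← (uIso W).Q.map_add, biprod.total]
    exact (uIso W).Q.map_id _
  have hθ := exchange_exchange (h₁ (U ⊓ V)) (h₂ _) (h₃ _) (h₄ _) (h₅ _) h
  have hθ₁ := exchange_snd (fst := onOpen (U ⊓ V) biprod.fst) (h₂ (U ⊓ V)) (h₃ _) h
  have hθ₂ := comp_inr_exchange (inl := onOpen (U ⊓ V) biprod.inl) (h₃ (U ⊓ V)) (h₄ _) h
  set θ : HomOn (U ⊓ V) (x ⊞ y) (x ⊞ y) := exchange _ _ _ _ _ _ σ τ with hθ_def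
  have : IsIso θ := ⟨θ, hθ, hθ⟩
  obtain ⟨c, α, α', β, β', hα, hβ, hαi, hαβ⟩ := exists_weak_gluing hU hV hW hUc hVc θ
  have hα₀ : resHom (inf_le_left : U ⊓ V ≤ U) α' ≫ resHom inf_le_left α = 𝟙 _ := by
    rw [← resHom_comp, hα, resHom_id]
  have hβ₀ : resHom (inf_le_right : U ⊓ V ≤ V) β' ≫ resHom inf_le_right β = 𝟙 _ := by
    rw [← resHom_comp, hβ, resHom_id]
  have hβ' : resHom (inf_le_right : U ⊓ V ≤ V) β' = θ ≫ resHom inf_le_left α' := by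
    have : IsIso (resHom (inf_le_right : U ⊓ V ≤ V) β) := by rw [← hαβ]; infer_instance
    rw [← cancel_mono (resHom (inf_le_right : U ⊓ V ≤ V) β), hβ₀, ← hαβ, Category.assoc,
      ← Category.assoc _ _ θ, hα₀, Category.id_comp, hθ]
  have hf : IdemIso (α ≫ onOpen U biprod.fst ≫ p ≫ onOpen U biprod.inl ≫ α') p
      (α ≫ onOpen U biprod.fst ≫ p) (p ≫ onOpen U biprod.inl ≫ α') := by
    refine ⟨?_, ?_, ?_, ?_⟩
    · simp only [Category.assoc]
      rw [← Category.assoc p p, hp]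
    · simp only [Category.assoc]
      rw [← Category.assoc α', hα, Category.id_comp, ← Category.assoc (onOpen U _) (onOpen U _),
        h₁, Category.id_comp, hp]
    · simp only [Category.assoc, hp]
    · rw [← Category.assoc, hp]
  have hg : IdemIso (β ≫ onOpen V biprod.snd ≫ q ≫ onOpen V biprod.inr ≫ β') q
      (β ≫ onOpen V biprod.snd ≫ q) (q ≫ onOpen V biprod.inr ≫ β') := by
    refine ⟨?_, ?_, ?_, ?_⟩
    · simp only [Category.assoc]
      rw [← Category.assoc q q, hq]
    · simp only [Category.assoc]
      rw [← Category.assoc β', hβ, Category.id_comp, ← Category.assoc (onOpen V _) (onOpen V _),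
        h₃, Category.id_comp, hq]
    · simp only [Category.assoc, hq]
    · rw [← Category.assoc, hq]
  have hgσ : resHom (inf_le_right : U ⊓ V ≤ V) (β ≫ onOpen V biprod.snd ≫ q) =
      resHom inf_le_left α ≫ onOpen (U ⊓ V) biprod.fst ≫ σ := by
    rw [resHom_comp, resHom_comp, resHom_onOpen, ← hαβ, Category.assoc, hθ₁]
  have hgτ : resHom (inf_le_right : U ⊓ V ≤ V) (q ≫ onOpen V biprod.inr ≫ β') =
      τ ≫ onOpen (U ⊓ V) biprod.inl ≫ resHom inf_le_left α' := by
    rw [resHom_comp, resHom_comp, resHom_onOpen, hβ', ← Category.assoc _ θ, ← Category.assoc,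
      hθ₂, Category.assoc]
  obtain ⟨e, he, heU, heV⟩ := exists_idempotent_of_eq_on_inf hU hV hW hUc hVc _ _ hf.idem_left
    hg.idem_left (by
      have e₂ := congrArg (resHom (inf_le_right : U ⊓ V ≤ V)) hg.hom_inv
      rw [resHom_comp, hgσ, hgτ] at e₂
      rw [← e₂]
      simp only [resHom_comp, resHom_onOpen, Category.assoc]
      rw [← h.hom_inv]
      simp only [Category.assoc])
  refine ⟨c, e, _, _, _, _, heU ▸ hf, heV ▸ hg, he, ?_⟩
  rw [hgσ]
  simp only [resHom_comp, resHom_onOpen, Category.assoc, h.comp_hom]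

end Gluing

/-! ### Connectivity between summands -/

section Local

variable {K : Type u} [Category.{v} K] [Preadditive K] [HasZeroObject K] [HasShift K ℤ]
  [∀ n : ℤ, (shiftFunctor K n).Additive] [Pretriangulated K] [IsTriangulated K]
  [MonoidalCategory K]

/-- A class of compact open subsets closed under binary intersections and unions. -/
structure IsCompactLattice (L : Opens (Spc K) → Prop) : Prop where
  inf {U V : Opens (Spc K)} : L U → L V → L (U ⊓ V)
  sup {U V : Opens (Spc K)} : L U → L V → L (U ⊔ V)
  isCompact {U : Opens (Spc K)} : L U → IsCompact (U : Set (Spc K))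

lemma IsCompactLattice.sup_insert {L : Opens (Spc K) → Prop} (hL : IsCompactLattice L)
    {ι : Type*} [DecidableEq ι] {O : ι → Opens (Spc K)} (hO : ∀ i, L (O i)) (o : ι)
    (s : Finset ι) : L ((insert o s).sup O) := by
  induction s using Finset.induction_on with
  | empty => simpa using hO o
  | insert i s _ ih => rw [Finset.insert_comm, Finset.sup_insert]; exact hL.sup (hO i) ih

variable {U V W O O' : Opens (Spc K)} {x y z w : K}

/-- On all members `V ⊆ O` of `L` there are no morphisms from the translation of the summand cut
out by `p` to the summand cut out by `q`. -/
def Connective (L : Opens (Spc K) → Prop) (O : Opens (Spc K)) (p : HomOn W x x)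
    (q : HomOn W y y) : Prop :=
  ∀ (V : Opens (Spc K)) (hV : V ≤ W), L V → V ≤ O → ∀ h : HomOn V (x⟦(1 : ℤ)⟧) y,
    twist (resHom hV p) ≫ h ≫ resHom hV q = 0

variable {L : Opens (Spc K) → Prop} {p : HomOn W x x} {q : HomOn W y y}

lemma Connective.mono (h : Connective L O p q) (hO : O' ≤ O) : Connective L O' p q :=
  fun V hV hL hVO => h V hV hL (hVO.trans hO)

lemma Connective.resHom (h : Connective L O p q) (hU : U ≤ W) :
    Connective L O (resHom hU p) (resHom hU q) := by
  intro V hV hL hVO g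
  rw [resHom_resHom, resHom_resHom]
  exact h V _ hL hVO g

lemma Connective.of_idemIso {r : HomOn V z z} (h : Connective L O r r) (hOV : O ≤ V) (hOW : O ≤ W)
    {f : HomOn O x z} {f' : HomOn O z x} {g : HomOn O y z} {g' : HomOn O z y}
    (hf : IdemIso (TTGlue.resHom hOW p) (TTGlue.resHom hOV r) f f')
    (hg : IdemIso (TTGlue.resHom hOW q) (TTGlue.resHom hOV r) g g') : Connective L O p q := by
  intro V' hV' hL hVO k
  have hf' := hf.resHom hVO
  have hg' := hg.resHom hVO
  simp only [resHom_resHom] at hf' hg'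
  have := h V' (hVO.trans hOV) hL hVO (twist (TTGlue.resHom hVO f') ≫ k ≫ TTGlue.resHom hVO g)
  rw [← hf'.hom_inv, ← hg'.hom_inv, ← hf'.comp_inv, ← hg'.hom_comp, twist_comp, twist_comp]
  simp only [Category.assoc] at this ⊢
  rw [← Category.assoc (TTGlue.resHom hVO g), ← Category.assoc k, ← Category.assoc (twist _) (k ≫ _),
    ← Category.assoc (twist (TTGlue.resHom _ r))]
  simp only [Category.assoc]
  rw [reassoc_of% this]
  simp

end Local

/-! ### Gluing over finite coverings -/

section Induction

variable {K : Type u} [Category.{v} K] [Preadditive K] [HasZeroObject K] [HasShift K ℤ]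
  [∀ n : ℤ, (shiftFunctor K n).Additive] [Pretriangulated K] [IsTriangulated K]
  [MonoidalCategory K] [SymmetricCategory K] [TensorTriangulated K] [MonoidalClosed K]
  [StronglyClosed K] {L : Opens (Spc K) → Prop} {ι : Type*} [DecidableEq ι] {o : ι}
  {x y : K}

/-- The overlap with each added `O a` lies inside `O a`, so connectivity is needed for the members
of `s` only, not for `o`. -/
lemma eq_zero_of_locally (hL : IsCompactLattice L) {O : ι → Opens (Spc K)} (hO : ∀ i, L (O i))
    (s : Finset ι) {W : Opens (Spc K)} (hW : W = (insert o s).sup O) {f : HomOn W x y}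
    {p : HomOn W x x} {q : HomOn W y y} (hp : p ≫ f = f) (hq : f ≫ q = f)
    (hf : ∀ i ∈ insert o s, ∀ h : O i ≤ W, resHom h f = 0)
    (hc : ∀ i ∈ s, Connective L (O i) p q) : f = 0 := by
  induction s using Finset.induction_on generalizing W with
  | empty =>
    have : W = O o := by simpa using hW
    subst this
    simpa using hf o (by simp) le_rfl
  | insert a s _ ih =>
    obtain ⟨W₀, hW₀⟩ : ∃ W₀, W₀ = (insert o s).sup O := ⟨_, rfl⟩
    have hW' : W = W₀ ⊔ O a := by
      rw [hW, hW₀, Finset.insert_comm, Finset.sup_insert, sup_comm]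
    have h₀ : W₀ ≤ W := hW' ▸ le_sup_left
    have ha : O a ≤ W := hW' ▸ le_sup_right
    have hL₀ : L W₀ := hW₀ ▸ hL.sup_insert hO o s
    refine eq_zero_of_resHom_eq_zero h₀ ha hW' (hL.isCompact hL₀) (hL.isCompact (hO a)) hp hq
      (ih hW₀ (p := resHom h₀ p) (q := resHom h₀ q) ?_ ?_ ?_ ?_) ?_ ?_
    · rw [← resHom_comp, hp]
    · rw [← resHom_comp, hq]
    · intro i hi h
      rw [resHom_resHom]
      exact hf i (by simp only [Finset.mem_insert] at hi ⊢; tauto) _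
    · exact fun i hi => (hc i (Finset.mem_insert_of_mem hi)).resHom h₀
    · exact hf a (by simp) ha
    · exact hc a (by simp) _ _ (hL.inf hL₀ (hO a)) inf_le_right

lemma exists_hom_of_locally (hL : IsCompactLattice L) {O : ι → Opens (Spc K)} (hO : ∀ i, L (O i))
    (s : Finset ι) {W : Opens (Spc K)} (hW : W = (insert o s).sup O)
    {p : HomOn W x x} {q : HomOn W y y} (hp : p ≫ p = p) (hq : q ≫ q = q)
    (m : ∀ i, HomOn (O i) x y)
    (hpm : ∀ i ∈ insert o s, ∀ h : O i ≤ W, resHom h p ≫ m i = m i)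
    (hmq : ∀ i ∈ insert o s, ∀ h : O i ≤ W, m i ≫ resHom h q = m i)
    (hm : ∀ i ∈ insert o s, ∀ j ∈ insert o s,
      resHom (inf_le_left : O i ⊓ O j ≤ O i) (m i) = resHom inf_le_right (m j))
    (hc : ∀ i ∈ s, Connective L (O i) p q) :
    ∃ f : HomOn W x y, p ≫ f = f ∧ f ≫ q = f ∧
      ∀ i ∈ insert o s, ∀ h : O i ≤ W, resHom h f = m i := by
  induction s using Finset.induction_on generalizing W with
  | empty =>
    have : W = O o := by simpa using hW
    subst this
    refine ⟨m o, by simpa using hpm o (by simp) le_rfl, by simpa using hmq o (by simp) le_rfl, ?_⟩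
    intro i hi h
    obtain rfl : i = o := by simpa using hi
    simp
  | insert a s _ ih =>
    obtain ⟨W₀, hW₀⟩ : ∃ W₀, W₀ = (insert o s).sup O := ⟨_, rfl⟩
    have hW' : W = W₀ ⊔ O a := by
      rw [hW, hW₀, Finset.insert_comm, Finset.sup_insert, sup_comm]
    have h₀ : W₀ ≤ W := hW' ▸ le_sup_left
    have ha : O a ≤ W := hW' ▸ le_sup_right
    have hL₀ : L W₀ := hW₀ ▸ hL.sup_insert hO o s
    have hmem : ∀ i ∈ insert o s, i ∈ insert o (insert a s) := by
      intro i hi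
      simp only [Finset.mem_insert] at hi ⊢
      tauto
    have ha' : a ∈ insert o (insert a s) := by simp
    obtain ⟨f₀, hpf₀, hf₀q, hf₀⟩ := ih hW₀ (p := resHom h₀ p) (q := resHom h₀ q)
      (by rw [← resHom_comp, hp]) (by rw [← resHom_comp, hq])
      (fun i hi h => by rw [resHom_resHom]; exact hpm i (hmem i hi) _)
      (fun i hi h => by rw [resHom_resHom]; exact hmq i (hmem i hi) _)
      (fun i hi j hj => hm i (hmem i hi) j (hmem j hj))
      (fun i hi => (hc i (Finset.mem_insert_of_mem hi)).resHom h₀)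
    -- Agreement on the overlap is checked on the cover by the `O i ⊓ O a`, where connectivity for
    -- `i ∈ s` again suffices.
    have heq : resHom (inf_le_left : W₀ ⊓ O a ≤ W₀) f₀ = resHom inf_le_right (m a) := by
      rw [← sub_eq_zero]
      have hD : W₀ ⊓ O a ≤ W := inf_le_left.trans h₀
      refine eq_zero_of_locally hL (O := fun i => O i ⊓ O a) (fun i => hL.inf (hO i) (hO a)) s
        (o := o) (by rw [hW₀, Finset.sup_inf_distrib_right]) (p := resHom hD p)
        (q := resHom hD q) ?_ ?_ ?_ ?_
      · have e₁ := congrArg (resHom (inf_le_left : W₀ ⊓ O a ≤ W₀)) hpf₀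
        have e₂ := congrArg (resHom (inf_le_right : W₀ ⊓ O a ≤ O a)) (hpm a ha' ha)
        rw [resHom_comp, resHom_resHom] at e₁ e₂
        rw [Preadditive.comp_sub, e₁, e₂]
      · have e₁ := congrArg (resHom (inf_le_left : W₀ ⊓ O a ≤ W₀)) hf₀q
        have e₂ := congrArg (resHom (inf_le_right : W₀ ⊓ O a ≤ O a)) (hmq a ha' ha)
        rw [resHom_comp, resHom_resHom] at e₁ e₂
        rw [Preadditive.sub_comp, e₁, e₂]
      · intro i hi h
        have hi' : O i ≤ W₀ := hW₀ ▸ Finset.le_sup hi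
        have e := hm i (hmem i hi) a ha'
        rw [← hf₀ i hi hi', resHom_resHom] at e
        rw [resHom_sub, resHom_resHom, resHom_resHom, e, sub_self]
      · exact fun i hi => ((hc i (Finset.mem_insert_of_mem hi)).mono inf_le_left).resHom hD
    obtain ⟨f, hf₁, hf₂⟩ := exists_hom_of_eq_on_inf h₀ ha hW' (hL.isCompact hL₀)
      (hL.isCompact (hO a)) f₀ (m a) heq
    -- A binary gluing need not respect the idempotents; compressing it by them leaves its
    -- restrictions unchanged.
    refine ⟨p ≫ f ≫ q, by rw [← Category.assoc, hp], by rw [Category.assoc, Category.assoc, hq],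
      ?_⟩
    intro i hi h
    have hi' : resHom h f = m i := by
      rw [Finset.insert_comm, Finset.mem_insert] at hi
      obtain rfl | hi := hi
      · exact hf₂
      · have hi' : O i ≤ W₀ := hW₀ ▸ Finset.le_sup hi
        rw [← hf₀ i hi hi', ← hf₁, resHom_resHom]
    rw [resHom_comp, resHom_comp, hi', hmq i hi h, hpm i hi h]

lemma hom_eq_of_locally (hL : IsCompactLattice L) {O : ι → Opens (Spc K)} (hO : ∀ i, L (O i))
    (s : Finset ι) {W : Opens (Spc K)} (hW : W = (insert o s).sup O) {f g : HomOn W x y}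
    {p : HomOn W x x} {q : HomOn W y y} (hpf : p ≫ f = f) (hfq : f ≫ q = f) (hpg : p ≫ g = g)
    (hgq : g ≫ q = g) (hf : ∀ i ∈ insert o s, ∀ h : O i ≤ W, resHom h f = resHom h g)
    (hc : ∀ i ∈ s, Connective L (O i) p q) : f = g := by
  rw [← sub_eq_zero]
  refine eq_zero_of_locally hL hO s hW (p := p) (q := q) (by rw [Preadditive.comp_sub, hpf, hpg])
    (by rw [Preadditive.sub_comp, hfq, hgq]) (fun i hi h => ?_) hc
  rw [resHom_sub, hf i hi h, sub_self]

/-- The local isomorphisms transport connectivity of `p` to every pairing of `p` and `q`, so the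
morphisms and their inverses both glue, and uniqueness makes the results inverse to each other. -/
lemma exists_idemIso_of_locally (hL : IsCompactLattice L) {O : ι → Opens (Spc K)}
    (hO : ∀ i, L (O i)) (s : Finset ι) {W : Opens (Spc K)} (hW : W = (insert o s).sup O)
    {p : HomOn W x x} {q : HomOn W y y} (hp : p ≫ p = p) (hq : q ≫ q = q)
    (m : ∀ i, HomOn (O i) x y) (m' : ∀ i, HomOn (O i) y x)
    (hm : ∀ i ∈ insert o s, ∀ h : O i ≤ W, IdemIso (resHom h p) (resHom h q) (m i) (m' i))
    (hmm : ∀ i ∈ insert o s, ∀ j ∈ insert o s,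
      resHom (inf_le_left : O i ⊓ O j ≤ O i) (m i) = resHom inf_le_right (m j))
    (hc : ∀ i ∈ s, Connective L (O i) p p) :
    ∃ (f : HomOn W x y) (f' : HomOn W y x), IdemIso p q f f' ∧
      ∀ i ∈ insert o s, ∀ h : O i ≤ W, resHom h f = m i := by
  have hOW : ∀ i ∈ insert o s, O i ≤ W := fun i hi => hW ▸ Finset.le_sup hi
  have hp' : ∀ i ∈ insert o s, ∀ h : O i ≤ W,
      IdemIso (resHom h p) (resHom h p) (resHom h p) (resHom h p) := fun i _ h =>
    IdemIso.refl (by rw [← resHom_comp, hp])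
  have hc₁ : ∀ i ∈ s, Connective L (O i) p q := fun i hi =>
    have h := hOW i (Finset.mem_insert_of_mem hi)
    (hc i hi).of_idemIso h h (hp' i (Finset.mem_insert_of_mem hi) h)
      (hm i (Finset.mem_insert_of_mem hi) h).symm
  have hc₂ : ∀ i ∈ s, Connective L (O i) q p := fun i hi =>
    have h := hOW i (Finset.mem_insert_of_mem hi)
    (hc i hi).of_idemIso h h (hm i (Finset.mem_insert_of_mem hi) h).symm
      (hp' i (Finset.mem_insert_of_mem hi) h)
  have hc₃ : ∀ i ∈ s, Connective L (O i) q q := fun i hi =>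
    have h := hOW i (Finset.mem_insert_of_mem hi)
    (hc i hi).of_idemIso h h (hm i (Finset.mem_insert_of_mem hi) h).symm
      (hm i (Finset.mem_insert_of_mem hi) h).symm
  obtain ⟨f, hpf, hfq, hf⟩ := exists_hom_of_locally hL hO s hW hp hq m
    (fun i hi h => (hm i hi h).comp_hom) (fun i hi h => (hm i hi h).hom_comp) hmm hc₁
  obtain ⟨f', hqf', hf'p, hf'⟩ := exists_hom_of_locally hL hO s hW hq hp m'
    (fun i hi h => (hm i hi h).comp_inv) (fun i hi h => (hm i hi h).inv_comp) (by
      intro i hi j hj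
      have h₁ := (hm i hi (hOW i hi)).resHom (inf_le_left : O i ⊓ O j ≤ O i)
      have h₂ := (hm j hj (hOW j hj)).resHom (inf_le_right : O i ⊓ O j ≤ O j)
      rw [hmm i hi j hj] at h₁
      simp only [resHom_resHom] at h₁ h₂
      exact h₁.inv_unique h₂) hc₂
  refine ⟨f, f', ⟨?_, ?_, hfq, hqf'⟩, hf⟩
  · refine hom_eq_of_locally hL hO s hW (p := p) (q := p) ?_ ?_ hp hp ?_ hc
    · rw [← Category.assoc, hpf]
    · rw [Category.assoc, hf'p]
    · intro i hi h
      rw [resHom_comp, hf i hi, hf' i hi, (hm i hi h).hom_inv]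
  · refine hom_eq_of_locally hL hO s hW (p := q) (q := q) ?_ ?_ hq hq ?_ hc₃
    · rw [← Category.assoc, hqf']
    · rw [Category.assoc, hfq]
    · intro i hi h
      rw [resHom_comp, hf i hi, hf' i hi, (hm i hi h).inv_hom]

/-- Direct summands of objects of `K` on the members of a covering, with compatible isomorphisms
on the intersections. -/
structure GluingDatum (U : ι → Opens (Spc K)) where
  X (i : ι) : K
  p (i : ι) : HomOn (U i) (X i) (X i)
  idem (i : ι) : p i ≫ p i = p i
  σ (i j : ι) : HomOn (U i ⊓ U j) (X i) (X j)
  σ' (i j : ι) : HomOn (U i ⊓ U j) (X j) (X i)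
  idemIso (i j : ι) : IdemIso (resHom inf_le_left (p i)) (resHom inf_le_right (p j)) (σ i j)
    (σ' i j)
  cocycle (i j k : ι) (V : Opens (Spc K)) (h₁ : V ≤ U i ⊓ U j) (h₂ : V ≤ U j ⊓ U k)
    (h₃ : V ≤ U i ⊓ U k) : resHom h₁ (σ i j) ≫ resHom h₂ (σ j k) = resHom h₃ (σ i k)

namespace GluingDatum

variable {U : ι → Opens (Spc K)} (G : GluingDatum U)

/-- By the cocycle condition it is idempotent, and it is invertible on the summand. -/
lemma σ_self (i : ι) : G.σ i i = resHom inf_le_left (G.p i) := by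
  have h := G.cocycle i i i _ le_rfl le_rfl le_rfl
  simp only [resHom_self] at h
  rw [← (G.idemIso i i).hom_inv]
  nth_rw 2 [← h]
  rw [Category.assoc, (G.idemIso i i).hom_inv]
  exact (G.idemIso i i).hom_comp.symm

lemma cocycle_symm (i j : ι) (V : Opens (Spc K)) (h₁ : V ≤ U i ⊓ U j) (h₂ : V ≤ U j ⊓ U i) :
    resHom h₁ (G.σ i j) ≫ resHom h₂ (G.σ j i) = resHom (h₁.trans inf_le_left) (G.p i) := by
  rw [G.cocycle i j i V h₁ h₂ (le_inf (h₁.trans inf_le_left) (h₁.trans inf_le_left)), σ_self,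
    resHom_resHom]

/-- The object of `K` and the morphisms form a gluing of the restriction of the datum to the
indices in `s`. -/
structure IsGluing (s : Finset ι) {W : Opens (Spc K)} {c : K} (e : HomOn W c c)
    (f : ∀ i, HomOn (U i) c (G.X i)) (f' : ∀ i, HomOn (U i) (G.X i) c) : Prop where
  idemIso : ∀ i ∈ s, ∀ h : U i ≤ W, IdemIso (resHom h e) (G.p i) (f i) (f' i)
  compat : ∀ i ∈ s, ∀ j ∈ s,
    resHom (inf_le_left : U i ⊓ U j ≤ U i) (f i) ≫ G.σ i j = resHom inf_le_right (f j)

variable {G}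

lemma IsGluing.compat_of_le {s : Finset ι} {W : Opens (Spc K)} {c : K} {e : HomOn W c c}
    {f : ∀ i, HomOn (U i) c (G.X i)} {f' : ∀ i, HomOn (U i) (G.X i) c}
    (h : G.IsGluing s e f f') {i j : ι} (hi : i ∈ s) (hj : j ∈ s) {V : Opens (Spc K)}
    (hV : V ≤ U i ⊓ U j) : resHom (hV.trans inf_le_left) (f i) ≫ resHom hV (G.σ i j) =
      resHom (hV.trans inf_le_right) (f j) := by
  have := congrArg (resHom hV) (h.compat i hi j hj)
  rwa [resHom_comp, resHom_resHom, resHom_resHom] at this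

lemma IsGluing.connective {s : Finset ι} {W : Opens (Spc K)} {c : K} {e : HomOn W c c}
    {f : ∀ i, HomOn (U i) c (G.X i)} {f' : ∀ i, HomOn (U i) (G.X i) c}
    (h : G.IsGluing s e f f') {i : ι} (hi : i ∈ s) (hW : U i ≤ W)
    (hc : Connective L (U i) (G.p i) (G.p i)) : Connective L (U i) e e := by
  have := h.idemIso i hi hW
  exact hc.of_idemIso le_rfl hW (f := f i) (f' := f' i) (g := f i) (g' := f' i)
    (by rwa [resHom_self]) (by rwa [resHom_self])

lemma exists_isGluing (hL : IsCompactLattice L) (hU : ∀ i, L (U i)) (s : Finset ι) (ho : o ∉ s)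
    (hc : ∀ i ∈ s, Connective L (U i) (G.p i) (G.p i)) {W : Opens (Spc K)}
    (hW : W = (insert o s).sup U) :
    ∃ (c : K) (e : HomOn W c c) (f : ∀ i, HomOn (U i) c (G.X i))
      (f' : ∀ i, HomOn (U i) (G.X i) c), e ≫ e = e ∧ G.IsGluing (insert o s) e f f' := by
  induction s using Finset.induction_on generalizing W with
  | empty =>
    have : W = U o := by simpa using hW
    subst this
    -- Values at indices outside the current finite set play no role and are set to zero.
    refine ⟨G.X o, G.p o, Function.update (fun _ => 0) o (G.p o),
      Function.update (fun _ => 0) o (G.p o), G.idem o, ?_, ?_⟩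
    · intro i hi h
      obtain rfl : i = o := by simpa using hi
      simpa using IdemIso.refl (G.idem i)
    · intro i hi j hj
      obtain rfl : i = o := by simpa using hi
      obtain rfl : j = i := by simpa using hj
      rw [Function.update_self]
      exact (G.idemIso j j).comp_hom.trans (G.σ_self j)
  | insert a s has ih =>
    obtain ⟨W₀, hW₀⟩ : ∃ W₀, W₀ = (insert o s).sup U := ⟨_, rfl⟩
    have hW' : W = W₀ ⊔ U a := by
      rw [hW, hW₀, Finset.insert_comm, Finset.sup_insert, sup_comm]
    have h₀ : W₀ ≤ W := hW' ▸ le_sup_left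
    have ha : U a ≤ W := hW' ▸ le_sup_right
    have hL₀ : L W₀ := hW₀ ▸ hL.sup_insert hU o s
    have hle : ∀ i ∈ insert o s, U i ≤ W₀ := fun i hi => hW₀ ▸ Finset.le_sup hi
    obtain ⟨c, e, f, f', he, hG⟩ := ih (fun h => ho (Finset.mem_insert_of_mem h))
      (fun i hi => hc i (Finset.mem_insert_of_mem hi)) hW₀
    -- The comparison of `c` with `X a` is assembled from the `f i ≫ σ i a`, which agree by the
    -- cocycle condition. Connectivity of `c` on `U i` comes from that of the `i`-th object.
    obtain ⟨σ, τ, hστ, hσ⟩ := exists_idemIso_of_locally hL (O := fun i => U i ⊓ U a)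
      (fun i => hL.inf (hU i) (hU a)) s (W := W₀ ⊓ U a) (o := o)
      (by rw [hW₀, Finset.sup_inf_distrib_right])
      (p := resHom inf_le_left e) (q := resHom inf_le_right (G.p a))
      (by rw [← resHom_comp, he]) (by rw [← resHom_comp, G.idem])
      (fun i => resHom inf_le_left (f i) ≫ G.σ i a) (fun i => G.σ' i a ≫ resHom inf_le_left (f' i))
      (by
        intro i hi h
        have h₁ := (hG.idemIso i hi (hle i hi)).resHom (inf_le_left : U i ⊓ U a ≤ U i)
        have h₂ := h₁.trans (G.idemIso i a)
        simp only [resHom_resHom] at h₂ ⊢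
        exact h₂)
      (by
        intro i hi j hj
        have hV : (U i ⊓ U a) ⊓ (U j ⊓ U a) ≤ U i ⊓ U j := inf_le_inf inf_le_left inf_le_left
        rw [resHom_comp, resHom_comp, resHom_resHom, resHom_resHom,
          ← hG.compat_of_le hi hj hV, Category.assoc, G.cocycle i j a])
      (fun i hi => ((hG.connective (Finset.mem_insert_of_mem hi)
        (hle i (Finset.mem_insert_of_mem hi))
        (hc i (Finset.mem_insert_of_mem hi))).mono inf_le_left).resHom _)
    obtain ⟨d, e', g, g', k, k', hg, hk, he', hgk⟩ := exists_gluing_pair h₀ ha hW'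
      (hL.isCompact hL₀) (hL.isCompact (hU a)) he (G.idem a) hστ
    have hne : ∀ i ∈ insert o s, i ≠ a := by
      rintro i hi rfl
      rw [Finset.mem_insert] at hi
      exact hi.elim (fun h => ho (h ▸ Finset.mem_insert_self _ _)) has
    classical
    refine ⟨d, e', Function.update (fun i => if h : U i ≤ W₀ then resHom h g ≫ f i else 0) a k,
      Function.update (fun i => if h : U i ≤ W₀ then f' i ≫ resHom h g' else 0) a k', he', ?_, ?_⟩
    · intro i hi h
      rw [Finset.insert_comm, Finset.mem_insert] at hi
      obtain rfl | hi := hi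
      · rwa [Function.update_self, Function.update_self]
      · rw [Function.update_of_ne (hne i hi), Function.update_of_ne (hne i hi), dif_pos (hle i hi),
          dif_pos (hle i hi)]
        have := (hg.resHom (hle i hi)).trans (hG.idemIso i hi (hle i hi))
        rwa [resHom_resHom] at this
    · have key : ∀ i (hi : i ∈ insert o s) (V : Opens (Spc K)) (hV : V ≤ U i ⊓ U a),
          resHom (hV.trans (inf_le_left.trans (hle i hi))) g ≫
            resHom (hV.trans inf_le_left) (f i) ≫ resHom hV (G.σ i a) =
              resHom (hV.trans inf_le_right) k := by
        intro i hi V hV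
        have e₁ := congrArg (resHom hV) (hσ i hi (inf_le_inf_right _ (hle i hi)))
        have e₂ := congrArg (resHom (hV.trans (inf_le_inf_right _ (hle i hi)))) hgk
        simp only [resHom_comp, resHom_resHom] at e₁ e₂
        rw [← e₁, e₂]
      intro i hi j hj
      rw [Finset.insert_comm, Finset.mem_insert] at hi hj
      obtain rfl | hi := hi
      · obtain rfl | hj := hj
        · rw [G.σ_self, Function.update_self, ← resHom_comp, hk.hom_comp]
        · rw [Function.update_self, Function.update_of_ne (hne j hj), dif_pos (hle j hj),
            ← key j hj _ (le_inf inf_le_right inf_le_left), Category.assoc, Category.assoc]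
          have := G.cocycle_symm j i (U i ⊓ U j) (le_inf inf_le_right inf_le_left) le_rfl
          rw [resHom_self] at this
          rw [this, ← resHom_comp _ (f j), (hG.idemIso j hj (hle j hj)).hom_comp, resHom_comp,
            resHom_resHom]
      · obtain rfl | hj := hj
        · rw [Function.update_self, Function.update_of_ne (hne i hi), dif_pos (hle i hi)]
          have := key i hi _ le_rfl
          rw [resHom_self] at this
          rw [resHom_comp, resHom_resHom, Category.assoc, this]
        · rw [Function.update_of_ne (hne i hi), dif_pos (hle i hi), Function.update_of_ne (hne j hj),
            dif_pos (hle j hj), resHom_comp, resHom_comp, Category.assoc, hG.compat i hi j hj,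
            resHom_resHom, resHom_resHom]

/-- On `U i` the isomorphism can only be `f i ≫ g' i`. These agree on overlaps and glue uniquely by
connectivity. -/
lemma existsUnique_idemIso (hL : IsCompactLattice L) (hU : ∀ i, L (U i)) (s : Finset ι)
    (hc : ∀ i ∈ s, Connective L (U i) (G.p i) (G.p i)) {W : Opens (Spc K)}
    (hW : W = (insert o s).sup U) {c d : K} {e : HomOn W c c} {e' : HomOn W d d}
    (he : e ≫ e = e) (he' : e' ≫ e' = e')
    {f : ∀ i, HomOn (U i) c (G.X i)} {f' : ∀ i, HomOn (U i) (G.X i) c}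
    {g : ∀ i, HomOn (U i) d (G.X i)} {g' : ∀ i, HomOn (U i) (G.X i) d}
    (hf : G.IsGluing (insert o s) e f f') (hg : G.IsGluing (insert o s) e' g g') :
    ∃ (k : HomOn W c d) (k' : HomOn W d c), IdemIso e e' k k' ∧
      (∀ i ∈ insert o s, ∀ h : U i ≤ W, resHom h k ≫ g i = f i) ∧
      ∀ l : HomOn W c d, e ≫ l = l → l ≫ e' = l →
        (∀ i ∈ insert o s, ∀ h : U i ≤ W, resHom h l ≫ g i = f i) → l = k := by
  have hle : ∀ i ∈ insert o s, U i ≤ W := fun i hi => hW ▸ Finset.le_sup hi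
  obtain ⟨k, k', hk, hkm⟩ := exists_idemIso_of_locally hL hU s hW he he' (fun i => f i ≫ g' i)
    (fun i => g i ≫ f' i) (fun i hi h => (hf.idemIso i hi h).trans (hg.idemIso i hi h).symm)
    (by
      intro i hi j hj
      have e₁ := ((hf.idemIso j hj (hle j hj)).resHom (inf_le_right : U i ⊓ U j ≤ U j))
      have e₂ := ((hg.idemIso i hi (hle i hi)).resHom (inf_le_left : U i ⊓ U j ≤ U i))
      have e₃ := ((hg.idemIso j hj (hle j hj)).resHom (inf_le_right : U i ⊓ U j ≤ U j))
      simp only [resHom_resHom] at e₂ e₃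
      have e₄ := e₂.trans (G.idemIso i j)
      rw [hg.compat i hi j hj] at e₄
      have e₅ := e₃.inv_unique e₄
      rw [resHom_comp, resHom_comp, ← hf.compat i hi j hj, e₅, Category.assoc,
        ← Category.assoc (G.σ i j), (G.idemIso i j).hom_inv, e₂.comp_inv])
    (fun i hi => hf.connective (Finset.mem_insert_of_mem hi) (hle i (Finset.mem_insert_of_mem hi))
      (hc i hi))
  refine ⟨k, k', hk, ?_, ?_⟩
  · intro i hi h
    rw [hkm i hi, Category.assoc, (hg.idemIso i hi h).inv_hom, (hf.idemIso i hi h).hom_comp]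
  · intro l hel hle' hl
    refine hom_eq_of_locally hL hU s hW hel hle' hk.comp_hom hk.hom_comp ?_ (fun i hi =>
      (hc i hi).of_idemIso le_rfl (hle i (Finset.mem_insert_of_mem hi)) (f := f i) (f' := f' i)
        (g := g i) (g' := g' i) (by simpa using hf.idemIso i (Finset.mem_insert_of_mem hi) _)
        (by simpa using hg.idemIso i (Finset.mem_insert_of_mem hi) _))
    intro i hi h
    have h₁ := hl i hi h
    rw [hkm i hi, ← h₁, Category.assoc, (hg.idemIso i hi h).hom_inv, ← resHom_comp, hle']

end GluingDatum

end Induction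

/-! ### Isomorphisms in the idempotent completion -/

section Karoubi

variable {C : Type*} [Category* C]

lemma idemIso_of_iso {A B : Karoubi C} (e : A ≅ B) : IdemIso A.p B.p e.hom.f e.inv.f where
  hom_inv := by rw [← Karoubi.comp_f, e.hom_inv_id, Karoubi.id_f]
  inv_hom := by rw [← Karoubi.comp_f, e.inv_hom_id, Karoubi.id_f]
  hom_comp := Karoubi.comp_p e.hom
  comp_inv := Karoubi.p_comp e.inv

/-- The isomorphism between the objects of the Karoubi envelope given by inverse isomorphisms
between direct summands. -/
def isoOfIdemIso {A B : Karoubi C} {f : A.X ⟶ B.X} {f' : B.X ⟶ A.X} (h : IdemIso A.p B.p f f') :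
    A ≅ B where
  hom := ⟨f, by rw [h.hom_comp, h.comp_hom]⟩
  inv := ⟨f', by rw [h.inv_comp, h.comp_inv]⟩
  hom_inv_id := Karoubi.hom_ext _ _ (by simpa using h.hom_inv)
  inv_hom_id := Karoubi.hom_ext _ _ (by simpa using h.inv_hom)

end Karoubi

/-! ### From `K(U)` to idempotents in `L(U)` -/

section Translation

variable {K : Type u} [Category.{v} K] [Preadditive K] [HasZeroObject K] [HasShift K ℤ]
  [∀ n : ℤ, (shiftFunctor K n).Additive] [Pretriangulated K] [IsTriangulated K]
  [MonoidalCategory K] {U U' V W : Opens (Spc K)}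

/-- The object of `K` of which `a` is a direct summand on `U`. -/
def ambient (a : KU U) : K := (Localization.Construction.objEquiv (uIso U)).symm a.X

/-- The idempotent on `U` which cuts out `a`. -/
def idempotent (a : KU U) : HomOn U (ambient a) (ambient a) := a.p

lemma idempotent_comp (a : KU U) : idempotent a ≫ idempotent a = idempotent a := a.idem

/-- The underlying morphism of an isomorphism on `V`. -/
noncomputable def IsoOn.toHom {h : V ≤ U} {h' : V ≤ U'} {a : KU U} {b : KU U'} (f : IsoOn V h h' a b) :
    HomOn V (ambient a) (ambient b) := f.hom.f

/-- The underlying morphism of the inverse of an isomorphism on `V`. -/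
noncomputable def IsoOn.toInv {h : V ≤ U} {h' : V ≤ U'} {a : KU U} {b : KU U'} (f : IsoOn V h h' a b) :
    HomOn V (ambient b) (ambient a) := f.inv.f

lemma IsoOn.idemIso {h : V ≤ U} {h' : V ≤ U'} {a : KU U} {b : KU U'} (f : IsoOn V h h' a b) :
    IdemIso (resHom h (idempotent a)) (resHom h' (idempotent b)) f.toHom f.toInv :=
  idemIso_of_iso (A := (res h).obj a) (B := (res h').obj b) f

lemma IsoOn.toHom_restrict {h : V ≤ U} {h' : V ≤ U'} {a : KU U} {b : KU U'} (f : IsoOn V h h' a b)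
    (hW : W ≤ V) : (f.restrict hW).toHom = resHom hW f.toHom := by
  have h₁ : ((resCompIso h hW).hom.app a).f = resHom (hW.trans h) (idempotent a) := by
    rw [resCompIso, eqToIso.hom, eqToHom_app, Karoubi.eqToHom_f]
    exact Category.comp_id _
  have h₂ : ((resCompIso h' hW).inv.app b).f = resHom (hW.trans h') (idempotent b) := by
    rw [resCompIso, eqToIso.inv, eqToHom_app, Karoubi.eqToHom_f]
    exact (Category.comp_id _).trans (resHom_resHom h' hW _)
  have h₃ : (f.restrict hW).toHom = resHom (hW.trans h) (idempotent a) ≫ resHom hW f.toHom ≫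
      resHom (hW.trans h') (idempotent b) := by
    rw [← h₁, ← h₂]
    rfl
  have h₄ := f.idemIso.resHom hW
  simp only [resHom_resHom] at h₄
  rw [h₃, h₄.hom_comp, h₄.comp_hom]

lemma IsoOn.toHom_trans {U'' : Opens (Spc K)} {h : V ≤ U} {h' : V ≤ U'} {h'' : V ≤ U''} {a : KU U}
    {b : KU U'} {c : KU U''} (f : IsoOn V h h' a b) (g : IsoOn V h' h'' b c) :
    IsoOn.toHom (f ≪≫ g : IsoOn V h h'' a c) = f.toHom ≫ g.toHom := rfl

/-- The underlying morphism of an isomorphism out of the restriction of an object of `K`. -/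
noncomputable def globalHom {c : K} {a : KU U} (f : (rho U).obj c ≅ a) :
    HomOn U c (ambient a) := f.hom.f

/-- The underlying morphism of the inverse of an isomorphism out of the restriction of an object
of `K`. -/
noncomputable def globalInv {c : K} {a : KU U} (f : (rho U).obj c ≅ a) :
    HomOn U (ambient a) c := f.inv.f

lemma idemIso_global {c : K} {a : KU U} (f : (rho U).obj c ≅ a) :
    IdemIso (𝟙 ((uIso U).Q.obj c)) (idempotent a) (globalHom f) (globalInv f) :=
  idemIso_of_iso (A := (rho U).obj c) (B := a) f

lemma restrictFromGlobal_hom_f {c : K} {a : KU U} (f : (rho U).obj c ≅ a) (h : V ≤ U) :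
    (restrictFromGlobal f h).hom.f = resHom h (globalHom f) := by
  have h₁ : ((rhoCompIso h).hom.app c).f = 𝟙 ((uIso V).Q.obj c) := by
    rw [rhoCompIso, eqToIso.hom, eqToHom_app, Karoubi.eqToHom_f]
    exact Category.comp_id _
  have h₂ : (restrictFromGlobal f h).hom.f = ((rhoCompIso h).hom.app c).f ≫
    (resL h).map f.hom.f := rfl
  rw [h₂, h₁]
  exact Category.id_comp _

lemma twist_eq_zero_of_connective {a : KU U} (h : V ≤ U)
    (H : ∀ f : (res h).obj ((shiftKU U).obj a) ⟶ (res h).obj a, f = 0)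
    (k : HomOn V ((ambient a)⟦(1 : ℤ)⟧) (ambient a)) :
    twist (resHom h (idempotent a)) ≫ k ≫ resHom h (idempotent a) = 0 := by
  -- `shiftKU` uses the shift of `L(U)`, while `twist` returns to that of `K`. The maps `κ`, `κ'`
  -- compare the two, and `P` is the idempotent of the translate of `a`.
  let c := ((uIso U).Q.commShiftIso (1 : ℤ)).app (ambient a)
  let P : (resL h).obj (((uIso U).Q.obj (ambient a))⟦(1 : ℤ)⟧) ⟶
    (resL h).obj (((uIso U).Q.obj (ambient a))⟦(1 : ℤ)⟧) :=
      (resL h).map ((idempotent a)⟦(1 : ℤ)⟧')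
  have hP : P ≫ P = P := by
    rw [← Functor.map_comp, ← Functor.map_comp, idempotent_comp]
  let κ : (resL h).obj (((uIso U).Q.obj (ambient a))⟦(1 : ℤ)⟧) ⟶
    (uIso V).Q.obj ((ambient a)⟦(1 : ℤ)⟧) := (resL h).map c.inv
  let κ' : (uIso V).Q.obj ((ambient a)⟦(1 : ℤ)⟧) ⟶
    (resL h).obj (((uIso U).Q.obj (ambient a))⟦(1 : ℤ)⟧) := (resL h).map c.hom
  have hq : resHom h (idempotent a) ≫ resHom h (idempotent a) = resHom h (idempotent a) := by
    rw [← resHom_comp, idempotent_comp]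
  have h₀ : P ≫ κ ≫ k ≫ resHom h (idempotent a) = 0 := by
    have := H ⟨P ≫ κ ≫ k ≫ resHom h (idempotent a), by
      change P ≫ (P ≫ κ ≫ k ≫ resHom h (idempotent a)) ≫ resHom h (idempotent a) =
        P ≫ κ ≫ k ≫ resHom h (idempotent a)
      simp only [Category.assoc, hq]
      rw [← Category.assoc P P, hP]⟩
    exact congrArg Karoubi.Hom.f this
  have h₁ : κ' ≫ P ≫ κ = twist (resHom h (idempotent a)) := by
    rw [← resHom_twist]
    exact (((resL h).map_comp _ _).trans (congrArg (κ' ≫ ·) ((resL h).map_comp _ _))).symm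
  rw [← h₁, Category.assoc, Category.assoc, h₀, comp_zero]

end Translation

/-! ### The whole spectrum, and the lattice generated by the covering -/

section Global

variable {K : Type u} [Category.{v} K] [Preadditive K] [HasZeroObject K] [HasShift K ℤ]
  [∀ n : ℤ, (shiftFunctor K n).Additive] [Pretriangulated K] [IsTriangulated K]
  [MonoidalCategory K] [SymmetricCategory K] [TensorTriangulated K] [MonoidalClosed K]
  [StronglyClosed K] {x y : K}

lemma isZero_of_supportedOn_empty (h : supportedOn ((⊤ : Opens (Spc K)) : Set (Spc K))ᶜ x) :
    IsZero x :=
  isZero_of_supp_eq_empty (Set.eq_empty_of_subset_empty (by simpa [supportedOn] using h))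

lemma onOpen_top_injective {f g : x ⟶ y} (h : onOpen ⊤ f = onOpen ⊤ g) : f = g := by
  rw [← sub_eq_zero]
  obtain ⟨z, hz, u, w, hf⟩ := exists_factorization_of_onOpen_eq_zero (U := (⊤ : Opens (Spc K)))
    (f := f - g) (((uIso ⊤).Q.map_sub).trans (sub_eq_zero.2 h))
  rw [← hf, (isZero_of_supportedOn_empty hz).eq_of_tgt u 0, zero_comp]

/-- The cone of a denominator has empty support, so the denominator is already invertible in `K`. -/
lemma onOpen_top_surjective (f : HomOn (⊤ : Opens (Spc K)) x y) : ∃ g : x ⟶ y, onOpen ⊤ g = f := by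
  obtain ⟨x', s, g, hs, hsg⟩ := exists_roof f
  have := isIso_onOpen hs
  obtain ⟨c, k, l, hT, hc⟩ := hs
  have : IsIso s := (distTriang_isIso₁ hT).2 (isZero_of_supportedOn_empty hc)
  refine ⟨inv s ≫ g, ?_⟩
  rw [← cancel_epi (onOpen ⊤ s), ← onOpen_comp, IsIso.hom_inv_id_assoc, hsg]

lemma isCompactLattice_of_cover {ι : Type*} [Fintype ι] [DecidableEq ι] {U : ι → Opens (Spc K)}
    (hU : ∀ i, IsCompact (U i : Set (Spc K))) (hcover : ⨆ i, U i = ⊤) :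
    IsCompactLattice fun V => ∃ S : Finset (Finset ι), V = S.sup fun s => s.inf U where
  inf := by
    rintro _ _ ⟨S, rfl⟩ ⟨T, rfl⟩
    refine ⟨(S ×ˢ T).image fun s => s.1 ∪ s.2, ?_⟩
    rw [Finset.sup_inf_sup, Finset.sup_image]
    exact Finset.sup_congr rfl fun s _ => Finset.inf_union.symm
  sup := by
    rintro _ _ ⟨S, rfl⟩ ⟨T, rfl⟩
    exact ⟨S ∪ T, Finset.sup_union.symm⟩
  isCompact := by
    rintro _ ⟨S, rfl⟩
    induction S using Finset.induction_on with
    | empty => simp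
    | insert s S hs ih =>
      rw [Finset.sup_insert, Opens.coe_sup]
      refine IsCompact.union ?_ ih
      clear ih hs
      induction s using Finset.induction_on with
      | empty =>
        -- The empty intersection is the whole space, compact as the finite union of the `U i`.
        rw [Finset.inf_empty, ← hcover, Opens.coe_iSup]
        exact isCompact_iUnion hU
      | insert i s _ ih =>
        rw [Finset.inf_insert]
        exact isCompact_inf (hU i) ih

end Global

/-! ### Cocycles and gluings in terms of idempotents -/

section Datum

variable {K : Type u} [Category.{v} K] [Preadditive K] [HasZeroObject K] [HasShift K ℤ]
  [∀ n : ℤ, (shiftFunctor K n).Additive] [Pretriangulated K] [IsTriangulated K]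
  [MonoidalCategory K] {n : ℕ} {U : Fin n → Opens (Spc K)} {a : ∀ i, KU (U i)}
  {σ : ∀ i j, IsoOn (U i ⊓ U j) inf_le_left inf_le_right (a i) (a j)}

/-- The gluing datum of direct summands given by a cocycle. -/
noncomputable def IsCocycle.datum (hσ : IsCocycle U a σ) : GluingDatum U where
  X i := ambient (a i)
  p i := idempotent (a i)
  idem i := idempotent_comp (a i)
  σ i j := (σ i j).toHom
  σ' i j := (σ i j).toInv
  idemIso i j := (σ i j).idemIso
  cocycle i j k V h₁ h₂ h₃ := by
    have h := congrArg IsoOn.toHom (hσ i j k)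
    rw [IsoOn.toHom_trans, IsoOn.toHom_restrict, IsoOn.toHom_restrict, IsoOn.toHom_restrict] at h
    have := congrArg (resHom (le_inf h₁ (h₃.trans inf_le_right) : V ≤ U i ⊓ U j ⊓ U k)) h
    simpa only [resHom_comp, resHom_resHom] using this

lemma Gluing.isGluing (hσ : IsCocycle U a σ) (g : Gluing U a σ) :
    hσ.datum.IsGluing Finset.univ (𝟙 ((uIso ⊤).Q.obj g.obj)) (fun i => globalHom (g.iso i))
      (fun i => globalInv (g.iso i)) where
  idemIso i _ h := by
    rw [resHom_id]
    exact idemIso_global (g.iso i)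
  compat i _ j _ := by
    have h := congrArg (fun e => e.hom.f) (g.compat i j)
    exact ((congrArg (· ≫ (σ i j).hom.f) (restrictFromGlobal_hom_f (g.iso i) inf_le_left)).symm.trans
      h).trans (restrictFromGlobal_hom_f (g.iso j) inf_le_right)

lemma GluingDatum.IsGluing.nonempty_gluing {hσ : IsCocycle U a σ} {c d : K}
    {e : HomOn (⊤ : Opens (Spc K)) c c} {f : ∀ i, HomOn (U i) c (ambient (a i))}
    {f' : ∀ i, HomOn (U i) (ambient (a i)) c} (hf : hσ.datum.IsGluing Finset.univ e f f')
    {k : d ⟶ c} {r : c ⟶ d} (hkr : k ≫ r = 𝟙 d) (hrk : onOpen ⊤ (r ≫ k) = e) :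
    Nonempty (Gluing U a σ) := by
  have h' (i : Fin n) : IdemIso (𝟙 ((uIso (U i)).Q.obj d)) (resHom le_top e) (onOpen (U i) k)
      (onOpen (U i) r) := by
    refine ⟨?_, ?_, ?_, ?_⟩
    · rw [← onOpen_comp, hkr]
      exact (uIso (U i)).Q.map_id d
    · rw [← hrk, resHom_onOpen, ← onOpen_comp]
    · rw [← hrk, resHom_onOpen, ← onOpen_comp, ← Category.assoc, hkr, Category.id_comp]
    · rw [← hrk, resHom_onOpen, ← onOpen_comp, Category.assoc, hkr, Category.comp_id]
  have h (i : Fin n) : IdemIso ((rho (U i)).obj d).p (a i).p (onOpen (U i) k ≫ f i)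
      (f' i ≫ onOpen (U i) r) :=
    (h' i).trans (hf.idemIso i (by simp) le_top)
  refine ⟨⟨d, fun i => isoOfIdemIso (h i), fun i j => ?_⟩⟩
  refine Iso.ext (Karoubi.hom_ext _ _ ?_)
  have e₁ := restrictFromGlobal_hom_f (isoOfIdemIso (h i)) (inf_le_left : U i ⊓ U j ≤ U i)
  have e₂ := restrictFromGlobal_hom_f (isoOfIdemIso (h j)) (inf_le_right : U i ⊓ U j ≤ U j)
  refine (congrArg (· ≫ (σ i j).hom.f) e₁).trans (Eq.trans ?_ e₂.symm)
  change resHom _ (onOpen (U i) k ≫ f i) ≫ hσ.datum.σ i j = resHom _ (onOpen (U j) k ≫ f j)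
  rw [resHom_comp, resHom_comp, resHom_onOpen, resHom_onOpen]
  exact (Category.assoc _ _ _).trans
    (congrArg (onOpen (U i ⊓ U j) k ≫ ·) (hf.compat i (by simp) j (by simp)))

end Datum

end TTGlue

/-! ### The gluing theorem -/

theorem mainTheorem5
    {K : Type u} [Category.{v} K] [Preadditive K] [HasZeroObject K] [HasShift K ℤ]
    [∀ n : ℤ, (shiftFunctor K n).Additive] [Pretriangulated K] [IsTriangulated K]
    [MonoidalCategory K] [SymmetricCategory K] [TTGlue.TensorTriangulated K]
    [MonoidalClosed K] [TTGlue.StronglyClosed K] [IsIdempotentComplete K]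
    (n : ℕ) (hn : 2 ≤ n) (U : Fin n → Opens (TTGlue.Spc K))
    (hU : ∀ i, IsCompact (U i : Set (TTGlue.Spc K))) (hcover : ⨆ i, U i = ⊤)
    (a : ∀ i, TTGlue.KU (U i))
    (σ : ∀ i j, TTGlue.IsoOn (U i ⊓ U j) inf_le_left inf_le_right (a i) (a j))
    (hσ : TTGlue.IsCocycle U a σ)
    (hconn : ∀ i : Fin n, 1 ≤ (i : ℕ) →
      ∀ (V : Opens (TTGlue.Spc K)) (hV : V ≤ U i), IsCompact (V : Set (TTGlue.Spc K)) →
        (∃ S : Finset (Finset (Fin n)), V = S.sup fun s => s.inf U) →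
        ∀ f : (TTGlue.res hV).obj ((TTGlue.shiftKU (U i)).obj (a i)) ⟶
            (TTGlue.res hV).obj (a i), f = 0) :
    Nonempty (TTGlue.Gluing U a σ) ∧
      ∀ g g' : TTGlue.Gluing U a σ, ∃! f : g.obj ≅ g'.obj, g.IsGluingIso g' f := by
  open TTGlue in
  -- The member exempt from connectivity starts the induction.
  let o : Fin n := ⟨0, by omega⟩
  have hL := isCompactLattice_of_cover hU hcover
  have hUL : ∀ i, ∃ S : Finset (Finset (Fin n)), U i = S.sup fun s => s.inf U :=
    fun i => ⟨{{i}}, by simp⟩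
  have hs : insert o (Finset.univ.erase o) = Finset.univ := Finset.insert_erase (Finset.mem_univ o)
  have hW : (⊤ : Opens (Spc K)) = (insert o (Finset.univ.erase o)).sup U := by
    rw [hs, Finset.sup_univ_eq_iSup, hcover]
  have hc : ∀ i ∈ Finset.univ.erase o,
      Connective (fun V => ∃ S : Finset (Finset (Fin n)), V = S.sup fun s => s.inf U) (U i)
        (hσ.datum.p i) (hσ.datum.p i) := by
    intro i hi V hV hVL _ k
    have hi' : 1 ≤ (i : ℕ) := by
      rw [Finset.mem_erase, Ne, Fin.ext_iff] at hi
      exact Nat.one_le_iff_ne_zero.2 hi.1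
    exact twist_eq_zero_of_connective hV (hconn i hi' V hV (hL.isCompact hVL) hVL) k
  refine ⟨?_, fun g g' => ?_⟩
  · obtain ⟨c, e, f, f', he, hf⟩ := GluingDatum.exists_isGluing (G := hσ.datum) hL hUL
      (Finset.univ.erase o) (by simp) hc hW
    rw [hs] at hf
    -- Full faithfulness of `K ⥤ L(⊤)` makes the glued idempotent one of `K`, where it splits.
    obtain ⟨ε, rfl⟩ := onOpen_top_surjective e
    obtain ⟨d, k, r, hkr, hrk⟩ := IsIdempotentComplete.idempotents_split c ε
      (onOpen_top_injective (by rw [onOpen_comp, he]))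
    exact hf.nonempty_gluing hkr (by rw [hrk])
  · obtain ⟨k, k', hk, hkg, hku⟩ := GluingDatum.existsUnique_idemIso hL hUL
      (Finset.univ.erase o) hc hW (Category.comp_id _) (Category.comp_id _)
      (by rw [hs]; exact g.isGluing hσ) (by rw [hs]; exact g'.isGluing hσ)
    obtain ⟨f, rfl⟩ := onOpen_top_surjective k
    obtain ⟨f', rfl⟩ := onOpen_top_surjective k'
    have hmem : ∀ i, i ∈ insert o (Finset.univ.erase o) := fun i => by rw [hs]; simp
    refine ⟨⟨f, f', onOpen_top_injective ?_, onOpen_top_injective ?_⟩, ?_, ?_⟩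
    · rw [onOpen_comp, hk.hom_inv]
      exact ((uIso ⊤).Q.map_id _).symm
    · rw [onOpen_comp, hk.inv_hom]
      exact ((uIso ⊤).Q.map_id _).symm
    · intro i
      have := hkg i (hmem i) le_top
      rw [resHom_onOpen] at this
      exact Iso.ext (Karoubi.hom_ext _ _ this)
    · intro l hl
      refine Iso.ext (onOpen_top_injective (hku _ (Category.id_comp _) (Category.comp_id _) ?_))
      intro i _ h
      rw [resHom_onOpen]
      exact congrArg (fun e => e.hom.f) (hl i)
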